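/- \textbf{Theorem (Deterministic phase transition).} For a set $E\subset\mathbb{C}$ let $\mathrm{Cap}(E)=\exp(-\inf_\mu I(\mu))$ be its logarithmic capacity, where $I(\mu)=\iint -\log|z-w|\,d\mu(z)\,d\mu(w)\in(-\infty,+\infty]$, the infimum is over the Borel probability measures $\mu$ whose support is a compact subset of $E$, and $e^{-\infty}=0$. Let $\lambda>0$ and let $(c_k)$ be a sequence in $(0,1)$. Put $\mathcal{A}_n=\{n,\dots,2n-1\}$ and $\mathcal{A}_{n,q}=\mathcal{A}_n\cup\mathcal{A}_{2n}\cup\dots\cup\mathcal{A}_{2^q n}$. Assume: (A.1) There is $\phi\in L^1([0,1],dx)$ with $\phi>0$ almost everywhere such that for every $f\in C([0,1])$, $$\frac1{\#\mathcal{A}_n}\sum_{k\in\mathcal{A}_n}f(c_k)\longrightarrow\int_0^1 f(x)\phi(x)\,dx\qquad(n\to\infty);$$ and there is a sequence of non-negative integers $q(n)\to\infty$ such that both of the following hold. (A.2) For every $\varepsilon>0$ there is $\delta>0$ such that for all sufficiently large $n$ and all $n',n''\in\{n,2n,\dots,2^{q(n)}n\}$, $$\frac{1}{\#(\mathcal{A}_{n'}\times\mathcal{A}_{n''})}\sum_{\substack{(i,j)\in\mathcal{A}_{n'}\times\mathcal{A}_{n''}\\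 i\ne j,\ |c_i-c_j|<\delta}}\bigl(-\log|c_i-c_j|\bigr)<\varepsilon .$$ (A.3) For every $\varepsilon>0$, for all sufficiently large $n$ and all $i\neq j$ in $\mathcal{A}_{n,q(n)}$, one has $c_i\ne c_j$ and $$\frac{e^{-\lambda i}+e^{-\lambda j}}{2|c_i-c_j|}<\varepsilon .$$ For $\alpha>0$ let $I_k^{\alpha}$ be the open interval with center $c_k$ and length $e^{-\lambda k^{\alpha}}$, and let $S_\alpha=\bigcap_m\bigcup_{k\ge m}I_k^{\alpha}$. Then (1) $\mathrm{Cap}(S_\alpha)=\mathrm{Cap}([0,1])>0$ for every $0<\alpha\le1$; (2) $\mathrm{Cap}(S_\alpha)=0$ for every $\alpha>1$. -/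

import Mathlib

open Filter Topology MeasureTheory Set

noncomputable section

/-- The logarithmic kernel `-log |z - w|` on the complex plane, with values in `[-∞, +∞]`
and equal to `+∞` on the diagonal. -/
def logKernel (z w : ℂ) : EReal := -ENNReal.log (edist z w)

/-- The interaction `I(ν, μ) = ∬ (-log |z - w|) dν(z) dμ(w)` of two positive measures: the integral
of the positive part of the kernel minus the integral of its negative part.
For finite measures with compact support the second integral is finite (the kernel is bounded
below there), so that no difference `∞ - ∞` occurs and the value lies in `(-∞, +∞]`. -/
def logInteraction (ν μ : Measure ℂ) : EReal :=
  ((∫⁻ w, ∫⁻ z, (logKernel z w).toENNReal ∂ν ∂μ : ENNReal) : EReal)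
    - ((∫⁻ w, ∫⁻ z, (-logKernel z w).toENNReal ∂ν ∂μ : ENNReal) : EReal)

/-- The logarithmic energy `I(μ) = I(μ, μ)`. -/
def logEnergy (μ : Measure ℂ) : EReal := logInteraction μ μ

/-- The Borel probability measures on `ℂ` whose (closed) support is a compact subset of `E`. -/
def compactlySupportedProbs (E : Set ℂ) : Set (Measure ℂ) :=
  {μ | IsProbabilityMeasure μ ∧ IsCompact μ.support ∧ μ.support ⊆ E}

/-- The logarithmic capacity `Cap(E) = exp (-inf I(μ))`, the infimum being over the Borel
probability measures whose support is a compact subset of `E`, with `exp (-∞) = 0`. -/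
def logCapacity (E : Set ℂ) : ENNReal :=
  EReal.exp (-(⨅ μ ∈ compactlySupportedProbs E, logEnergy μ))

/-- Capacity of a subset of the real line, seen as a subset of `ℂ`. -/
def realCapacity (E : Set ℝ) : ENNReal := logCapacity ((fun x : ℝ => (x : ℂ)) '' E)

/-- `S = ⋂ m, ⋃ k ≥ m, I_k`, where `I_k` is the open interval of center `c k` and length `l k`. -/
def limsupIntervals (c l : ℕ → ℝ) : Set ℝ :=
  ⋂ m : ℕ, ⋃ k ≥ m, Ioo (c k - l k / 2) (c k + l k / 2)

/-- The index block `A_n = {n, …, 2n - 1}`. -/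
def block (n : ℕ) : Finset ℕ := Finset.Ico n (2 * n)

/-- The index set `A_{n,q} = A_n ∪ A_{2n} ∪ ⋯ ∪ A_{2^q n}`. -/
def multiBlock (n q : ℕ) : Finset ℕ :=
  (Finset.range (q + 1)).biUnion fun s => block (2 ^ s * n)

/-- Distribution: the block averages of the centers converge weakly to `φ(x) dx` for an integrable
density `φ` on `[0,1]` that is positive almost everywhere. -/
def CentersDistributed (c : ℕ → ℝ) : Prop :=
  ∃ φ : ℝ → ℝ, IntegrableOn φ (Icc 0 1) ∧ (∀ᵐ x ∂(volume.restrict (Icc (0 : ℝ) 1)), 0 < φ x) ∧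
    ∀ f : ℝ → ℝ, ContinuousOn f (Icc 0 1) →
      Tendsto (fun n : ℕ => (∑ k ∈ block n, f (c k)) / ((block n).card : ℝ)) atTop
        (𝓝 (∫ x in Icc (0 : ℝ) 1, f x * φ x))

/-- Log-average spacing. Here `n'` and `n''` are `2 ^ s * n` and `2 ^ t * n` with `s, t ≤ q n`.
(The condition is only used together with `GapControl` for the same `q`; the latter makes all the
centers with indices in `A_{n,q(n)}` distinct for large `n`, so that `log 0` does not occur.) -/
def LogAverageSpacing (c : ℕ → ℝ) (q : ℕ → ℕ) : Prop :=
  ∀ ε > (0 : ℝ), ∃ δ > (0 : ℝ), ∀ᶠ n : ℕ in atTop, ∀ s ≤ q n, ∀ t ≤ q n,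
    (∑ p ∈ (block (2 ^ s * n) ×ˢ block (2 ^ t * n)) with
        (p.1 ≠ p.2 ∧ |c p.1 - c p.2| < δ), -Real.log |c p.1 - c p.2|)
      / ((block (2 ^ s * n) ×ˢ block (2 ^ t * n)).card : ℝ) < ε

/-- Gap control. Coinciding centers (an infinite quotient) violate the condition. -/
def GapControl (c l : ℕ → ℝ) (q : ℕ → ℕ) : Prop :=
  ∀ ε > (0 : ℝ), ∀ᶠ n : ℕ in atTop, ∀ i ∈ multiBlock n (q n), ∀ j ∈ multiBlock n (q n), i ≠ j →
    c i ≠ c j ∧ (l i + l j) / (2 * |c i - c j|) < ε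

end

/-!
A measure `ν` on the line is controlled through its positive energy `∬ log⁺ (1 / |x - y|) dν dν`,
which on subsets of `[0, 1]` is the logarithmic energy.

Suppose `∑ 1 / a_k` converges, where `a_k = log (1 / |I_k|)`, and let `ν` have finite energy. Any
subset `J` of `I_k` satisfies `ν J ≤ s / a_k + a_k * ν J ^ 2 / s`, by comparing `a_k * ν J` with
`s`, and the sum of `a_k * ν J_k ^ 2` over disjoint pieces `J_k ⊆ I_k` is at most the energy. Hence
the limsup set has measure at most `energy / s` for every `s`, that is, measure zero.

If the centers are well distributed and separated, any probability measure of energy less than `B`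
on `[0, 1]` can be moved to the limsup set with energy at most `B`. First smooth it, so that it
has a density with respect to the limit law `P` of the centers, and even a bounded continuous one.
Then replace `P` by the empirical law of the centers over many consecutive dyadic blocks, each
atom being spread uniformly over half of its interval. The off-diagonal energy converges to that
of the density. The diagonal energy of one block does not tend to zero, since its average is of
the order of `log (1 / |I_k|) / k`, but the mixture over `q` blocks divides it by `q`. The new
measure has again a density and energy less than `B`, and it lives on intervals inside the
previous open set, so the step can be repeated inside nested compact sets; a weak limit is carried
by the limsup set, and the energy is lower semicontinuous.
-/

noncomputable section

open ProbabilityTheory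
open scoped BoundedContinuousFunction ENNReal NNReal

/-! ### Energy on the real line -/

section Energy

variable {X : Type*} [PseudoEMetricSpace X]

/-- The positive part `log⁺ (1 / |x - y|)` of the logarithmic kernel; it is `∞` on the diagonal. -/
def posLog (x y : X) : ℝ≥0∞ := (-ENNReal.log (edist x y)).toENNReal

lemma continuous_posLog : Continuous fun p : X × X => posLog p.1 p.2 :=
  EReal.continuous_toENNReal.comp (continuous_neg.comp
    (ENNReal.continuous_log.comp continuous_edist))

lemma posLog_self (x : X) : posLog x x = ∞ := by
  simp [posLog]

lemma posLog_of_ne {x y : ℝ} (h : x ≠ y) : posLog x y = ENNReal.ofReal (-Real.log |x - y|) := by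
  rw [posLog, edist_dist, Real.dist_eq, ENNReal.log_ofReal_of_pos (abs_pos.2 (sub_ne_zero.2 h)),
    ← EReal.coe_neg, EReal.real_coe_toENNReal]

lemma posLog_le_of_le_abs_sub {x y a : ℝ} (ha : 0 < a) (h : a ≤ |x - y|) :
    posLog x y ≤ ENNReal.ofReal (-Real.log a) := by
  rw [posLog_of_ne (sub_ne_zero.1 (abs_pos.1 (ha.trans_le h)))]
  exact ENNReal.ofReal_le_ofReal (neg_le_neg (Real.log_le_log ha h))

lemma le_posLog_of_abs_sub_le {x y a : ℝ} (h : |x - y| ≤ a) :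
    ENNReal.ofReal (-Real.log a) ≤ posLog x y := by
  rcases eq_or_ne x y with rfl | hxy
  · simp only [posLog_self, le_top]
  rw [posLog_of_ne hxy]
  exact ENNReal.ofReal_le_ofReal (neg_le_neg (Real.log_le_log (abs_pos.2 (sub_ne_zero.2 hxy)) h))

variable [MeasurableSpace X]

/-- The mutual energy of two measures for the positive part of the logarithmic kernel. On a set of
diameter at most `1` this is the logarithmic energy, with the advantage of being a Lebesgue integral
that is always defined. -/
def posEnergy (ν μ : Measure X) : ℝ≥0∞ := ∫⁻ y, ∫⁻ x, posLog x y ∂ν ∂μ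

lemma posEnergy_mono {ν ν' μ μ' : Measure X} (hν : ν ≤ ν') (hμ : μ ≤ μ') :
    posEnergy ν μ ≤ posEnergy ν' μ' :=
  lintegral_mono' hμ fun _ => lintegral_mono' hν le_rfl

lemma posEnergy_smul {a : ℝ≥0∞} (ha : a ≠ ∞) (ν μ : Measure X) :
    posEnergy (a • ν) (a • μ) = a * a * posEnergy ν μ := by
  simp only [posEnergy, lintegral_smul_measure, smul_eq_mul]
  rw [lintegral_const_mul' _ _ ha, mul_assoc]

section Measurable

variable [OpensMeasurableSpace X] [SecondCountableTopology X]

lemma measurable_posLog : Measurable fun p : X × X => posLog p.1 p.2 :=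
  continuous_posLog.measurable

lemma posEnergy_eq_lintegral_prod (ν μ : Measure X) [SFinite ν] [SFinite μ] :
    posEnergy ν μ = ∫⁻ p, posLog p.1 p.2 ∂(ν.prod μ) := by
  rw [lintegral_prod_symm _ measurable_posLog.aemeasurable, posEnergy]

end Measurable

lemma posEnergy_map {Y : Type*} [PseudoEMetricSpace Y] [MeasurableSpace Y] {f : X → Y}
    (hf : Isometry f) (hfm : MeasurableEmbedding f) (ν μ : Measure X) :
    posEnergy (ν.map f) (μ.map f) = posEnergy ν μ := by
  simp only [posEnergy, hfm.lintegral_map, posLog, hf.edist_eq]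

end Energy

section Composition

variable {X ι : Type*} [MeasurableSpace X] [MeasurableSpace ι] [PseudoEMetricSpace X]
  [OpensMeasurableSpace X] [SecondCountableTopology X]

lemma posEnergy_withDensity {F : X → ℝ≥0∞} (hF : Measurable F) (P : Measure X) [SFinite P] :
    posEnergy (P.withDensity F) (P.withDensity F)
      = ∫⁻ p, F p.1 * F p.2 * posLog p.1 p.2 ∂(P.prod P) := by
  rw [posEnergy_eq_lintegral_prod, prod_withDensity hF hF,
    lintegral_withDensity_eq_lintegral_mul _ (by fun_prop) measurable_posLog]
  rfl

variable (κ : Kernel ι X) [IsSFiniteKernel κ]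

lemma measurable_posEnergy_kernel :
    Measurable fun p : ι × ι => posEnergy (κ p.1) (κ p.2) := by
  have h : ∀ p : ι × ι, posEnergy (κ p.1) (κ p.2) = ∫⁻ q, posLog q.1 q.2 ∂((κ ∥ₖ κ) p) :=
    fun p => by rw [Kernel.parallelComp_apply, posEnergy_eq_lintegral_prod]
  simp_rw [h]
  exact measurable_posLog.lintegral_kernel

lemma posEnergy_bind (m : Measure ι) [SFinite m] :
    posEnergy (m.bind κ) (m.bind κ) = ∫⁻ p, posEnergy (κ p.1) (κ p.2) ∂(m.prod m) := by
  have hκ : AEMeasurable κ m := κ.measurable.aemeasurable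
  have hpot : Measurable fun y => ∫⁻ x, posLog x y ∂(m.bind κ) :=
    measurable_posLog.lintegral_prod_left'
  rw [lintegral_prod_symm _ (measurable_posEnergy_kernel κ).aemeasurable, posEnergy,
    Measure.lintegral_bind hκ hpot.aemeasurable]
  refine lintegral_congr fun j => ?_
  have hswap : ∀ μ : Measure X, SFinite μ →
      ∫⁻ y, ∫⁻ x, posLog x y ∂μ ∂(κ j) = ∫⁻ x, ∫⁻ y, posLog x y ∂(κ j) ∂μ := fun μ _ =>
    lintegral_lintegral_swap (measurable_posLog.comp measurable_swap).aemeasurable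
  rw [hswap _ inferInstance, Measure.lintegral_bind hκ
    (measurable_posLog.lintegral_prod_right' (ν := κ j)).aemeasurable]
  exact lintegral_congr fun i => (hswap _ inferInstance).symm

end Composition

section Capacity

lemma logEnergy_eq_sub (μ : Measure ℂ) : logEnergy μ = (posEnergy μ μ : EReal)
      - ((∫⁻ w, ∫⁻ z, (-logKernel z w).toENNReal ∂μ ∂μ : ℝ≥0∞) : EReal) :=
  rfl

lemma lintegral_neg_logKernel_le (μ : Measure ℂ) [IsProbabilityMeasure μ] {S : Set ℂ}
    (hS : ∀ᵐ z ∂μ, z ∈ S) :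
    ∫⁻ w, ∫⁻ z, (-logKernel z w).toENNReal ∂μ ∂μ ≤ (ENNReal.log (Metric.ediam S)).toENNReal := by
  have hle : ∀ᵐ w ∂μ, ∀ᵐ z ∂μ,
      (-logKernel z w).toENNReal ≤ (ENNReal.log (Metric.ediam S)).toENNReal := by
    filter_upwards [hS] with w hw
    filter_upwards [hS] with z hz
    rw [logKernel, neg_neg]
    exact EReal.toENNReal_le_toENNReal
      (ENNReal.log_monotone (Metric.edist_le_ediam_of_mem hz hw))
  refine (lintegral_mono_ae (hle.mono fun w hw => lintegral_mono_ae hw)).trans_eq ?_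
  simp only [lintegral_const, measure_univ, mul_one]

lemma logEnergy_eq_posEnergy {μ : Measure ℂ} [IsProbabilityMeasure μ] {S : Set ℂ}
    (hμ : ∀ᵐ z ∂μ, z ∈ S) (hS : Metric.ediam S ≤ 1) : logEnergy μ = posEnergy μ μ := by
  have h0 : ∫⁻ w, ∫⁻ z, (-logKernel z w).toENNReal ∂μ ∂μ = 0 := by
    refine le_zero_iff.1 ((lintegral_neg_logKernel_le μ hμ).trans_eq ?_)
    exact EReal.toENNReal_of_nonpos (ENNReal.log_le_zero_iff.2 hS)
  simp [logEnergy_eq_sub, h0]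

lemma logEnergy_eq_top {μ : Measure ℂ} [IsProbabilityMeasure μ] (hμ : IsCompact μ.support)
    (h : posEnergy μ μ = ∞) : logEnergy μ = ⊤ := by
  have hfin : ∫⁻ w, ∫⁻ z, (-logKernel z w).toENNReal ∂μ ∂μ ≠ ∞ := by
    refine ne_top_of_le_ne_top ?_ (lintegral_neg_logKernel_le μ Measure.support_mem_ae)
    rw [Ne, EReal.toENNReal_eq_top_iff, ENNReal.log_eq_top_iff]
    exact hμ.isBounded.ediam_ne_top
  rw [logEnergy_eq_sub, h, EReal.coe_ennreal_top,
    EReal.top_sub (EReal.coe_ennreal_eq_top_iff.not.2 hfin)]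

lemma measurableEmbedding_complex_ofReal : MeasurableEmbedding ((↑) : ℝ → ℂ) :=
  Complex.isometry_ofReal.isClosedEmbedding.measurableEmbedding

lemma posEnergy_map_ofReal (ν : Measure ℝ) :
    posEnergy (ν.map ((↑) : ℝ → ℂ)) (ν.map ((↑) : ℝ → ℂ)) = posEnergy ν ν :=
  posEnergy_map Complex.isometry_ofReal measurableEmbedding_complex_ofReal ν ν

lemma logEnergy_map_ofReal (ν : Measure ℝ) [IsProbabilityMeasure ν] (hν : ν (Icc 0 1)ᶜ = 0) :
    logEnergy (ν.map ((↑) : ℝ → ℂ)) = posEnergy ν ν := by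
  have := Measure.isProbabilityMeasure_map (μ := ν) Complex.measurable_ofReal.aemeasurable
  have hae : ∀ᵐ z ∂(ν.map ((↑) : ℝ → ℂ)), z ∈ (fun x : ℝ => (x : ℂ)) '' Icc 0 1 := by
    refine (measurableEmbedding_complex_ofReal.ae_map_iff).2 ?_
    filter_upwards [show ∀ᵐ x ∂ν, x ∈ Icc (0 : ℝ) 1 from hν] with x hx using mem_image_of_mem _ hx
  rw [logEnergy_eq_posEnergy hae, posEnergy_map_ofReal]
  rw [Complex.isometry_ofReal.ediam_image, Real.ediam_Icc, sub_zero, ENNReal.ofReal_one]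

lemma exists_real_measure {E : Set ℝ} {μ : Measure ℂ}
    (hμ : μ ∈ compactlySupportedProbs ((fun x : ℝ => (x : ℂ)) '' E)) :
    ∃ ν : Measure ℝ, IsProbabilityMeasure ν ∧ ν Eᶜ = 0 ∧ μ = ν.map ((↑) : ℝ → ℂ) := by
  obtain ⟨hμ, -, hE⟩ := hμ
  have hae : ∀ᵐ z ∂μ, z ∈ (fun x : ℝ => (x : ℂ)) '' E :=
    mem_of_superset Measure.support_mem_ae hE
  have hrange : ∀ᵐ z ∂μ, z ∈ range ((↑) : ℝ → ℂ) :=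
    hae.mono fun z hz => image_subset_range _ _ hz
  refine ⟨μ.comap (↑), measurableEmbedding_complex_ofReal.isProbabilityMeasure_comap hrange, ?_, ?_⟩
  · rw [measurableEmbedding_complex_ofReal.comap_apply]
    refine measure_mono_null ?_ hae
    rintro _ ⟨x, hx, rfl⟩ ⟨y, hy, hxy⟩
    exact hx (Complex.ofReal_injective hxy ▸ hy)
  · rw [measurableEmbedding_complex_ofReal.map_comap, Measure.restrict_eq_self_of_ae_mem hrange]

lemma map_ofReal_mem_compactlySupportedProbs {E K : Set ℝ} (hK : IsCompact K) (hKE : K ⊆ E)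
    (ν : Measure ℝ) [IsProbabilityMeasure ν] (hν : ν Kᶜ = 0) :
    ν.map ((↑) : ℝ → ℂ) ∈ compactlySupportedProbs ((fun x : ℝ => (x : ℂ)) '' E) := by
  have hK' : IsCompact ((fun x : ℝ => (x : ℂ)) '' K) := hK.image Complex.continuous_ofReal
  have hsupp : (ν.map ((↑) : ℝ → ℂ)).support ⊆ (fun x : ℝ => (x : ℂ)) '' K := by
    refine Measure.support_subset_of_isClosed hK'.isClosed ?_
    refine (measurableEmbedding_complex_ofReal.ae_map_iff).2 ?_
    filter_upwards [show ∀ᵐ x ∂ν, x ∈ K from hν] with x hx using mem_image_of_mem _ hx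
  exact ⟨Measure.isProbabilityMeasure_map Complex.measurable_ofReal.aemeasurable,
    hK'.of_isClosed_subset Measure.isClosed_support hsupp, hsupp.trans (image_mono hKE)⟩

lemma logCapacity_mono {E F : Set ℂ} (h : E ⊆ F) : logCapacity E ≤ logCapacity F := by
  refine EReal.exp_monotone (EReal.neg_le_neg_iff.2 ?_)
  exact biInf_mono fun μ hμ => ⟨hμ.1, hμ.2.1, hμ.2.2.trans h⟩

lemma realCapacity_mono {E F : Set ℝ} (h : E ⊆ F) : realCapacity E ≤ realCapacity F :=
  logCapacity_mono (image_mono h)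

lemma realCapacity_le_of_posEnergy {E F : Set ℝ} (hF : F ⊆ Icc 0 1) (hE : E ⊆ Icc 0 1)
    (h : ∀ ν : Measure ℝ, IsProbabilityMeasure ν → ν Fᶜ = 0 → ∀ B, posEnergy ν ν < B →
      ∃ K ⊆ E, IsCompact K ∧ ∃ ν' : Measure ℝ, IsProbabilityMeasure ν' ∧ ν' Kᶜ = 0 ∧
        posEnergy ν' ν' ≤ B) :
    realCapacity F ≤ realCapacity E := by
  refine EReal.exp_monotone (EReal.neg_le_neg_iff.2 (le_iInf₂ fun μ hμ => ?_))
  obtain ⟨ν, hν, hνF, rfl⟩ := exists_real_measure hμ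
  rw [logEnergy_map_ofReal ν (measure_mono_null (compl_subset_compl.2 hF) hνF)]
  have hmem : ∀ B, posEnergy ν ν < B →
      ⨅ μ ∈ compactlySupportedProbs ((fun x : ℝ => (x : ℂ)) '' E), logEnergy μ ≤ (B : EReal) := by
    intro B hB
    obtain ⟨K, hKE, hK, ν', hν', hν'K, hle⟩ := h ν hν hνF B hB
    refine (iInf₂_le _ (map_ofReal_mem_compactlySupportedProbs hK hKE ν' hν'K)).trans ?_
    rw [logEnergy_map_ofReal ν' (measure_mono_null (compl_subset_compl.2 (hKE.trans hE)) hν'K)]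
    exact EReal.coe_ennreal_le_coe_ennreal_iff.2 hle
  refine le_of_forall_gt_imp_ge_of_dense fun b hb => ?_
  have hb' : (b.toENNReal : EReal) = b :=
    EReal.coe_toENNReal ((EReal.coe_ennreal_nonneg _).trans hb.le)
  rw [← hb'] at hb ⊢
  exact hmem _ (EReal.coe_ennreal_lt_coe_ennreal_iff.1 hb)

lemma realCapacity_eq_zero_of_posEnergy {E : Set ℝ}
    (h : ∀ ν : Measure ℝ, IsProbabilityMeasure ν → ν Eᶜ = 0 → posEnergy ν ν = ∞) :
    realCapacity E = 0 := by
  have htop : (⨅ μ ∈ compactlySupportedProbs ((fun x : ℝ => (x : ℂ)) '' E), logEnergy μ) = ⊤ := by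
    refine iInf₂_eq_top.2 fun μ hμ => ?_
    obtain ⟨ν, hν, hνE, rfl⟩ := exists_real_measure hμ
    have := hμ.1
    exact logEnergy_eq_top hμ.2.1 ((posEnergy_map_ofReal ν).trans (h ν hν hνE))
  rw [realCapacity, logCapacity, htop, EReal.neg_top, EReal.exp_bot]

lemma realCapacity_pos_of_posEnergy {K : Set ℝ} (hK : IsCompact K) (ν : Measure ℝ)
    [IsProbabilityMeasure ν] (hν : ν Kᶜ = 0) (h : posEnergy ν ν ≠ ∞) : 0 < realCapacity K := by
  have hmem := map_ofReal_mem_compactlySupportedProbs hK Subset.rfl ν hν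
  have hlt : logEnergy (ν.map ((↑) : ℝ → ℂ)) < ⊤ := by
    rw [logEnergy_eq_sub, posEnergy_map_ofReal]
    refine (EReal.sub_le_sub le_rfl (EReal.coe_ennreal_nonneg _)).trans_lt ?_
    rwa [sub_zero, lt_top_iff_ne_top, Ne, EReal.coe_ennreal_eq_top_iff]
  rw [realCapacity, logCapacity, pos_iff_ne_zero, Ne, EReal.exp_eq_zero_iff, EReal.neg_eq_bot_iff]
  exact ((iInf₂_le _ hmem).trans_lt hlt).ne

end Capacity

/-! ### Convergent sums of inverse logarithms -/

section BorelCantelli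

variable {X : Type*} [PseudoEMetricSpace X] [MeasurableSpace X] (ν : Measure X)

lemma tsum_mul_measure_mul_self_le_posEnergy {ι : Type*} [Countable ι] {J : ι → Set X}
    (hJ : Pairwise (Function.onFun Disjoint J)) (hJm : ∀ k, MeasurableSet (J k)) {a : ι → ℝ≥0∞}
    (ha : ∀ k, ∀ x ∈ J k, ∀ y ∈ J k, a k ≤ posLog x y) :
    ∑' k, a k * ν (J k) * ν (J k) ≤ posEnergy ν ν :=
  calc ∑' k, a k * ν (J k) * ν (J k)
      = ∑' k, ∫⁻ _ in J k, ∫⁻ _ in J k, a k ∂ν ∂ν := by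
        simp only [lintegral_const, Measure.restrict_apply_univ]
    _ ≤ ∑' k, ∫⁻ y in J k, ∫⁻ x, posLog x y ∂ν ∂ν := by
        refine ENNReal.tsum_le_tsum fun k => setLIntegral_mono' (hJm k) fun y hy => ?_
        exact (setLIntegral_mono' (hJm k) fun x hx => ha k x hx y hy).trans
          (setLIntegral_le_lintegral _ _)
    _ = ∫⁻ y in ⋃ k, J k, ∫⁻ x, posLog x y ∂ν ∂ν := (lintegral_iUnion hJm hJ _).symm
    _ ≤ posEnergy ν ν := setLIntegral_le_lintegral _ _

lemma le_mul_inv_add_inv_mul {s : ℝ≥0∞} (hs₀ : s ≠ 0) (hs : s ≠ ∞) (a x : ℝ≥0∞) :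
    x ≤ s * a⁻¹ + s⁻¹ * (a * x * x) := by
  rcases le_total (a * x) s with h | h
  · refine le_add_right ?_
    rw [← div_eq_mul_inv, ENNReal.le_div_iff_mul_le (Or.inr hs₀) (Or.inr hs), mul_comm]
    exact h
  · refine le_add_left ?_
    calc x = s⁻¹ * s * x := by rw [ENNReal.inv_mul_cancel hs₀ hs, one_mul]
      _ ≤ s⁻¹ * (a * x * x) := by rw [mul_assoc]; gcongr

variable {A : ℕ → Set X} (hA : ∀ k, MeasurableSet (A k)) {a : ℕ → ℝ≥0∞}
  (ha : ∀ k, ∀ x ∈ A k, ∀ y ∈ A k, a k ≤ posLog x y)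
include hA ha

lemma measure_iUnion_le_mul_tsum_inv_add_posEnergy {s : ℝ≥0∞} (hs₀ : s ≠ 0) (hs : s ≠ ∞) :
    ν (⋃ k, A k) ≤ s * ∑' k, (a k)⁻¹ + s⁻¹ * posEnergy ν ν := by
  have hJm : ∀ k, MeasurableSet (disjointed A k) := MeasurableSet.disjointed hA
  have hJ : ∀ k, ∀ x ∈ disjointed A k, ∀ y ∈ disjointed A k, a k ≤ posLog x y :=
    fun k x hx y hy => ha k x (disjointed_subset A k hx) y (disjointed_subset A k hy)
  rw [← iUnion_disjointed, measure_iUnion (disjoint_disjointed A) hJm]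
  refine (ENNReal.tsum_le_tsum fun k => le_mul_inv_add_inv_mul hs₀ hs (a k) _).trans ?_
  rw [ENNReal.tsum_add, ENNReal.tsum_mul_left, ENNReal.tsum_mul_left]
  gcongr
  exact tsum_mul_measure_mul_self_le_posEnergy ν (disjoint_disjointed A) hJm hJ

lemma measure_limsup_eq_zero_of_posEnergy_ne_top (hν : posEnergy ν ν ≠ ∞)
    (hsum : ∑' k, (a k)⁻¹ ≠ ∞) : ν (limsup A atTop) = 0 := by
  have hle : ∀ s : ℝ≥0∞, s ≠ 0 → s ≠ ∞ → ν (limsup A atTop) ≤ s⁻¹ * posEnergy ν ν := by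
    intro s hs₀ hs
    have hN : ∀ N, ν (limsup A atTop) ≤ s * ∑' k, (a (k + N))⁻¹ + s⁻¹ * posEnergy ν ν := by
      intro N
      refine (measure_mono ?_).trans (measure_iUnion_le_mul_tsum_inv_add_posEnergy ν
        (fun k => hA (k + N)) (fun k => ha (k + N)) hs₀ hs)
      rw [limsup_eq_iInf_iSup_of_nat']
      exact (iInf_le _ N).trans_eq (iSup_eq_iUnion _)
    have hlim : Tendsto (fun N => s * ∑' k, (a (k + N))⁻¹ + s⁻¹ * posEnergy ν ν) atTop
        (𝓝 (s * 0 + s⁻¹ * posEnergy ν ν)) :=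
      (ENNReal.Tendsto.const_mul (ENNReal.tendsto_sum_nat_add _ hsum) (Or.inr hs)).add_const _
    simpa only [mul_zero, zero_add] using ge_of_tendsto' hlim hN
  have hlim : Tendsto (fun n : ℕ => (n : ℝ≥0∞)⁻¹ * posEnergy ν ν) atTop (𝓝 (0 * posEnergy ν ν)) :=
    ENNReal.Tendsto.mul_const ENNReal.tendsto_inv_nat_nhds_zero (Or.inr hν)
  rw [zero_mul] at hlim
  refine le_zero_iff.1 (ge_of_tendsto hlim ?_)
  filter_upwards [eventually_ne_atTop 0] with n hn
  exact hle n (Nat.cast_ne_zero.2 hn) (ENNReal.natCast_ne_top n)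

end BorelCantelli

lemma limsupIntervals_eq_limsup (c l : ℕ → ℝ) :
    limsupIntervals c l = limsup (fun k => Ioo (c k - l k / 2) (c k + l k / 2)) atTop := by
  simp only [limsupIntervals, limsup_eq_iInf_iSup_of_nat, iInf_eq_iInter, iSup_eq_iUnion, ge_iff_le]

theorem realCapacity_limsupIntervals_eq_zero {l : ℕ → ℝ} (hl : ∀ᶠ k in atTop, l k ∈ Ioo 0 1)
    (hsum : Summable fun k => (Real.log (l k))⁻¹) (c : ℕ → ℝ) :
    realCapacity (limsupIntervals c l) = 0 := by
  obtain ⟨N, hN⟩ := hl.exists_forall_of_atTop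
  refine realCapacity_eq_zero_of_posEnergy fun ν hν hνS => ?_
  by_contra hfin
  rw [limsupIntervals_eq_limsup, ← limsup_nat_add _ N] at hνS
  set A : ℕ → Set ℝ := fun k =>
    Ioo (c (k + N) - l (k + N) / 2) (c (k + N) + l (k + N) / 2)
  have hlog : ∀ k, 0 < -Real.log (l (k + N)) := fun k =>
    neg_pos.2 (Real.log_neg (hN _ (N.le_add_left k)).1 (hN _ (N.le_add_left k)).2)
  have ha : ∀ k, ∀ x ∈ A k, ∀ y ∈ A k, ENNReal.ofReal (-Real.log (l (k + N))) ≤ posLog x y := by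
    refine fun k x hx y hy => le_posLog_of_abs_sub_le (abs_sub_le_iff.2 ⟨?_, ?_⟩) <;>
      linarith [hx.1, hx.2, hy.1, hy.2]
  have hsum' : ∑' k, (ENNReal.ofReal (-Real.log (l (k + N))))⁻¹ ≠ ∞ := by
    simp_rw [← ENNReal.ofReal_inv_of_pos (hlog _), inv_neg]
    exact ((summable_nat_add_iff N).2 hsum).neg.tsum_ofReal_ne_top
  have hzero : ν (limsup A atTop) = 0 := measure_limsup_eq_zero_of_posEnergy_ne_top ν
    (fun k => measurableSet_Ioo) ha hfin hsum'
  have hone : ν univ = 0 := by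
    rw [← union_compl_self (limsup A atTop)]
    exact measure_union_null hzero hνS
  exact one_ne_zero (measure_univ.symm.trans hone)

/-! ### Uniform measures on intervals -/

section UniformInterval

/-- The uniform distribution on the open interval of center `c` and length `ℓ` (zero if
`ℓ ≤ 0`). -/
def uniformInterval (c ℓ : ℝ) : Measure ℝ :=
  ENNReal.ofReal ℓ⁻¹ • volume.restrict (Ioo (c - ℓ / 2) (c + ℓ / 2))

lemma isProbabilityMeasure_uniformInterval (c : ℝ) {ℓ : ℝ} (hℓ : 0 < ℓ) :
    IsProbabilityMeasure (uniformInterval c ℓ) := by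
  refine ⟨?_⟩
  rw [uniformInterval, Measure.smul_apply, Measure.restrict_apply_univ, Real.volume_Ioo,
    smul_eq_mul, add_sub_sub_cancel, add_halves, ← ENNReal.ofReal_mul (by positivity),
    inv_mul_cancel₀ hℓ.ne', ENNReal.ofReal_one]

instance (c ℓ : ℝ) : IsZeroOrProbabilityMeasure (uniformInterval c ℓ) := by
  rcases lt_or_ge 0 ℓ with hℓ | hℓ
  · have := isProbabilityMeasure_uniformInterval c hℓ
    infer_instance
  · rw [uniformInterval, ENNReal.ofReal_of_nonpos (inv_nonpos.2 hℓ), zero_smul]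
    infer_instance

lemma uniformInterval_compl_Ioo (c ℓ : ℝ) :
    uniformInterval c ℓ (Ioo (c - ℓ / 2) (c + ℓ / 2))ᶜ = 0 := by
  rw [uniformInterval, Measure.smul_apply, Measure.restrict_apply measurableSet_Ioo.compl,
    compl_inter_self, measure_empty, smul_zero]

lemma uniformInterval_absolutelyContinuous (c ℓ : ℝ) : uniformInterval c ℓ ≪ volume :=
  (Measure.absolutelyContinuous_of_le Measure.restrict_le_self).smul_left _

lemma measurable_uniformInterval : Measurable fun p : ℝ × ℝ => uniformInterval p.1 p.2 := by
  refine Measure.measurable_of_measurable_coe _ fun s hs => ?_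
  have hT : MeasurableSet {q : (ℝ × ℝ) × ℝ |
      q.2 ∈ s ∧ q.1.1 - q.1.2 / 2 < q.2 ∧ q.2 < q.1.1 + q.1.2 / 2} :=
    (measurable_snd hs).inter
      ((measurableSet_lt (f := fun q : (ℝ × ℝ) × ℝ => q.1.1 - q.1.2 / 2) (by fun_prop)
        measurable_snd).inter
      (measurableSet_lt (g := fun q : (ℝ × ℝ) × ℝ => q.1.1 + q.1.2 / 2) measurable_snd
        (by fun_prop)))
  simp only [uniformInterval, Measure.smul_apply, Measure.restrict_apply hs, smul_eq_mul]
  exact (by fun_prop : Measurable fun p : ℝ × ℝ => ENNReal.ofReal p.2⁻¹).mul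
    (measurable_measure_prodMk_left hT)

lemma lintegral_ofReal_log_sub_log_abs_sub (y : ℝ) {ℓ : ℝ} (hℓ : 0 < ℓ) :
    ∫⁻ x, ENNReal.ofReal (Real.log ℓ - Real.log |x - y|) = ENNReal.ofReal (2 * ℓ) := by
  have hsupp : (fun x => ENNReal.ofReal (Real.log ℓ - Real.log x)).support ⊆ Ioc (-ℓ) ℓ := by
    refine Function.support_subset_iff'.2 fun x hx => ENNReal.ofReal_of_nonpos (sub_nonpos.2 ?_)
    rw [← Real.log_abs x]
    refine Real.log_le_log hℓ (le_abs'.2 ?_)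
    by_contra! h
    exact hx ⟨h.1, h.2.le⟩
  have hint : IntervalIntegrable (fun x => Real.log ℓ - Real.log x) volume (-ℓ) ℓ :=
    intervalIntegrable_const.sub intervalIntegral.intervalIntegrable_log'
  have hnonneg : 0 ≤ᵐ[volume.restrict (Ioc (-ℓ) ℓ)] fun x => Real.log ℓ - Real.log x := by
    filter_upwards [ae_restrict_mem measurableSet_Ioc,
      ae_restrict_of_ae (compl_mem_ae_iff.2 (measure_singleton (0 : ℝ)))] with x hx hx0
    rw [Pi.zero_apply, sub_nonneg, ← Real.log_abs x]
    exact Real.log_le_log (abs_pos.2 hx0) (abs_le.2 ⟨hx.1.le, hx.2⟩)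
  have hle : -ℓ ≤ ℓ := by linarith
  simp only [Real.log_abs]
  rw [lintegral_sub_right_eq_self (fun x => ENNReal.ofReal (Real.log ℓ - Real.log x)) y,
    ← setLIntegral_eq_of_support_subset hsupp, ← ofReal_integral_eq_lintegral_ofReal
      ((intervalIntegrable_iff_integrableOn_Ioc_of_le hle).1 hint) hnonneg,
    ← intervalIntegral.integral_of_le hle, intervalIntegral.integral_sub intervalIntegrable_const
      intervalIntegral.intervalIntegrable_log', integral_log, intervalIntegral.integral_const,
    Real.log_neg_eq_log, smul_eq_mul]
  congr 1
  ring

lemma lintegral_posLog_uniformInterval_le (c y : ℝ) {ℓ : ℝ} (hℓ : 0 < ℓ) :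
    ∫⁻ x, posLog x y ∂(uniformInterval c ℓ) ≤ ENNReal.ofReal (-Real.log ℓ) + 2 := by
  have := isProbabilityMeasure_uniformInterval c hℓ
  have hne : ∀ᵐ x ∂(uniformInterval c ℓ), x ≠ y :=
    (uniformInterval_absolutelyContinuous c ℓ).ae_le (compl_mem_ae_iff.2 (measure_singleton y))
  calc ∫⁻ x, posLog x y ∂(uniformInterval c ℓ)
      ≤ ∫⁻ x, (ENNReal.ofReal (-Real.log ℓ) + ENNReal.ofReal (Real.log ℓ - Real.log |x - y|))
          ∂(uniformInterval c ℓ) := by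
        refine lintegral_mono_ae (hne.mono fun x hx => ?_)
        rw [posLog_of_ne hx]
        refine le_trans (ENNReal.ofReal_le_ofReal ?_) ENNReal.ofReal_add_le
        linarith
    _ = ENNReal.ofReal (-Real.log ℓ) + ENNReal.ofReal ℓ⁻¹ *
          ∫⁻ x in Ioo (c - ℓ / 2) (c + ℓ / 2), ENNReal.ofReal (Real.log ℓ - Real.log |x - y|) := by
        rw [lintegral_add_left measurable_const, lintegral_const, measure_univ, mul_one,
          uniformInterval, lintegral_smul_measure, smul_eq_mul]
    _ ≤ ENNReal.ofReal (-Real.log ℓ) + ENNReal.ofReal ℓ⁻¹ * ENNReal.ofReal (2 * ℓ) := by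
        gcongr
        exact (setLIntegral_le_lintegral _ _).trans_eq (lintegral_ofReal_log_sub_log_abs_sub y hℓ)
    _ = ENNReal.ofReal (-Real.log ℓ) + 2 := by
        rw [← ENNReal.ofReal_mul (by positivity), mul_comm 2, inv_mul_cancel_left₀ hℓ.ne',
          ENNReal.ofReal_ofNat]

lemma posEnergy_uniformInterval_le (c c' : ℝ) {ℓ : ℝ} (hℓ : 0 < ℓ) (ℓ' : ℝ) :
    posEnergy (uniformInterval c ℓ) (uniformInterval c' ℓ') ≤ ENNReal.ofReal (-Real.log ℓ) + 2 :=
  calc posEnergy (uniformInterval c ℓ) (uniformInterval c' ℓ')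
      ≤ ∫⁻ _, (ENNReal.ofReal (-Real.log ℓ) + 2) ∂(uniformInterval c' ℓ') :=
        lintegral_mono fun y => lintegral_posLog_uniformInterval_le c y hℓ
    _ ≤ ENNReal.ofReal (-Real.log ℓ) + 2 := by
        rw [lintegral_const]
        exact mul_le_of_le_one_right' prob_le_one

lemma posLog_le_of_abs_sub_center_le {c c' x y d ε : ℝ} (hε₀ : 0 ≤ ε) (hε : ε ≤ 1 / 2)
    (hc : c ≠ c') (hd : d ≤ ε * |c - c'|) (h : |c - c'| ≤ |x - y| + d) :
    posLog x y ≤ posLog c c' + ENNReal.ofReal (2 * ε) := by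
  have hpos : 0 < |c - c'| := abs_pos.2 (sub_ne_zero.2 hc)
  have hlog : -Real.log ((1 - ε) * |c - c'|) ≤ -Real.log |c - c'| + 2 * ε := by
    rw [Real.log_mul (by linarith) hpos.ne']
    have hle := Real.one_sub_inv_le_log_of_pos (show 0 < 1 - ε by linarith)
    have hinv : (1 - ε)⁻¹ ≤ 1 + 2 * ε := by
      rw [inv_le_iff_one_le_mul₀ (by linarith)]
      nlinarith
    linarith
  rw [posLog_of_ne hc]
  exact (posLog_le_of_le_abs_sub (mul_pos (by linarith) hpos) (by linarith)).trans
    ((ENNReal.ofReal_le_ofReal hlog).trans ENNReal.ofReal_add_le)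

lemma posEnergy_uniformInterval_le_posLog_add {c c' ℓ ℓ' ε : ℝ} (hε₀ : 0 ≤ ε) (hε : ε ≤ 1 / 2)
    (hc : c ≠ c') (h : (ℓ + ℓ') / 2 ≤ ε * |c - c'|) :
    posEnergy (uniformInterval c ℓ) (uniformInterval c' ℓ')
      ≤ posLog c c' + ENNReal.ofReal (2 * ε) := by
  have hae : ∀ c ℓ : ℝ, ∀ᵐ x ∂(uniformInterval c ℓ), x ∈ Ioo (c - ℓ / 2) (c + ℓ / 2) :=
    uniformInterval_compl_Ioo
  calc posEnergy (uniformInterval c ℓ) (uniformInterval c' ℓ')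
      ≤ ∫⁻ _, ∫⁻ _, (posLog c c' + ENNReal.ofReal (2 * ε))
          ∂(uniformInterval c ℓ) ∂(uniformInterval c' ℓ') := by
        refine lintegral_mono_ae ((hae c' ℓ').mono fun y hy => ?_)
        refine lintegral_mono_ae ((hae c ℓ).mono fun x hx => ?_)
        refine posLog_le_of_abs_sub_center_le hε₀ hε hc h (abs_le.2 ⟨?_, ?_⟩)
        · linarith [hx.1, hx.2, hy.1, hy.2, neg_abs_le (x - y)]
        · linarith [hx.1, hx.2, hy.1, hy.2, le_abs_self (x - y)]
    _ ≤ posLog c c' + ENNReal.ofReal (2 * ε) := by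
        rw [lintegral_const, lintegral_const, mul_assoc]
        exact mul_le_of_le_one_right' (mul_le_one' prob_le_one prob_le_one)

lemma realCapacity_Icc_pos : 0 < realCapacity (Icc 0 1) := by
  have := isProbabilityMeasure_uniformInterval (1 / 2) one_pos
  refine realCapacity_pos_of_posEnergy isCompact_Icc (uniformInterval (1 / 2) 1) ?_ ?_
  · refine measure_mono_null (compl_subset_compl.2 ?_) (uniformInterval_compl_Ioo (1 / 2) 1)
    norm_num [Ioo_subset_Icc_self]
  · refine ne_top_of_le_ne_top ?_ (posEnergy_uniformInterval_le _ _ one_pos 1)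
    exact ENNReal.add_ne_top.2 ⟨ENNReal.ofReal_ne_top, ENNReal.ofNat_ne_top⟩

section Kernel

variable {α : Type*} [MeasurableSpace α] {c ℓ : α → ℝ}

/-- The transition kernel spreading the mass at `a` uniformly over the interval of center `c a` and
length `ℓ a`. -/
def uniformKernel (hc : Measurable c) (hℓ : Measurable ℓ) : Kernel α ℝ where
  toFun a := uniformInterval (c a) (ℓ a)
  measurable' := measurable_uniformInterval.comp (hc.prodMk hℓ)

variable (hc : Measurable c) (hℓ : Measurable ℓ)

lemma uniformKernel_apply (a : α) : uniformKernel hc hℓ a = uniformInterval (c a) (ℓ a) := rfl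

instance : IsFiniteKernel (uniformKernel hc hℓ) :=
  ⟨1, ENNReal.one_lt_top, fun a => by rw [uniformKernel_apply]; exact prob_le_one⟩

lemma isMarkovKernel_uniformKernel (hpos : ∀ a, 0 < ℓ a) : IsMarkovKernel (uniformKernel hc hℓ) :=
  ⟨fun a => isProbabilityMeasure_uniformInterval (c a) (hpos a)⟩

lemma bind_uniformKernel_absolutelyContinuous (m : Measure α) [SFinite m] :
    m.bind (uniformKernel hc hℓ) ≪ volume := by
  have h : m.bind (uniformKernel hc hℓ) ≪ m.bind (Kernel.const α volume) :=
    Measure.AbsolutelyContinuous.comp_left m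
      (Eventually.of_forall fun a => uniformInterval_absolutelyContinuous (c a) (ℓ a))
  rw [Measure.const_comp] at h
  exact h.trans (Measure.smul_absolutelyContinuous)

lemma bind_uniformKernel_compl_eq_zero {m : Measure α} {S : Set ℝ} (hS : MeasurableSet S)
    (h : ∀ᵐ a ∂m, Ioo (c a - ℓ a / 2) (c a + ℓ a / 2) ⊆ S) :
    m.bind (uniformKernel hc hℓ) Sᶜ = 0 := by
  rw [Measure.bind_apply hS.compl (uniformKernel hc hℓ).measurable.aemeasurable]
  refine lintegral_eq_zero_of_ae_eq_zero (h.mono fun a ha => ?_)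
  exact measure_mono_null (compl_subset_compl.2 ha) (uniformInterval_compl_Ioo _ _)

end Kernel

end UniformInterval

section Smoothing

/-- The kernel taking `x` to the law of `(1 - η) x + η U`, where `U` is uniform on `(0, 1)`. It
preserves `(0, 1)` and makes every measure absolutely continuous. -/
def smoothingKernel (η : ℝ) : Kernel ℝ ℝ :=
  uniformKernel (c := fun x => (1 - η) * x + η / 2) (ℓ := fun _ => η) (by fun_prop)
    measurable_const

instance (η : ℝ) : IsFiniteKernel (smoothingKernel η) :=
  inferInstanceAs (IsFiniteKernel (uniformKernel _ _))

lemma abs_sub_smoothing_center {η : ℝ} (hη : η < 1) (x y : ℝ) :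
    |(1 - η) * x + η / 2 - ((1 - η) * y + η / 2)| = (1 - η) * |x - y| := by
  rw [add_sub_add_right_eq_sub, ← mul_sub, abs_mul, abs_of_pos (by linarith)]

lemma posEnergy_smoothingKernel_le_posLog_add {η ε : ℝ} (hη : η < 1) (hε₀ : 0 ≤ ε)
    (hε : ε ≤ 1 / 2) {x y : ℝ} (hxy : x ≠ y) (h : η ≤ ε * ((1 - η) * |x - y|)) :
    posEnergy (smoothingKernel η x) (smoothingKernel η y)
      ≤ ENNReal.ofReal (-Real.log ((1 - η) * |x - y|)) + ENNReal.ofReal (2 * ε) := by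
  have habs := abs_sub_smoothing_center hη x y
  have hne : (1 - η) * x + η / 2 ≠ (1 - η) * y + η / 2 := by
    rw [← sub_ne_zero, ← abs_pos, habs]
    exact mul_pos (by linarith) (abs_pos.2 (sub_ne_zero.2 hxy))
  rw [← habs, ← posLog_of_ne hne]
  refine posEnergy_uniformInterval_le_posLog_add hε₀ hε hne ?_
  rw [habs, add_self_div_two]
  exact h

lemma posEnergy_smoothingKernel_le {η : ℝ} (hη₀ : 0 < η) (hη : η ≤ 1 / 2) (x y : ℝ) :
    posEnergy (smoothingKernel η x) (smoothingKernel η y)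
      ≤ posLog x y + (ENNReal.ofReal (Real.log 4) + 2) := by
  rcases eq_or_ne x y with rfl | hxy
  · simp only [posLog_self, top_add, le_top]
  have hd : 0 < |x - y| := abs_pos.2 (sub_ne_zero.2 hxy)
  have hscale : ∀ r > 0, |x - y| / 4 ≤ r →
      ENNReal.ofReal (-Real.log r) ≤ posLog x y + ENNReal.ofReal (Real.log 4) := by
    intro r _ hr
    have hlog := Real.log_le_log (by positivity) hr
    rw [Real.log_div hd.ne' (by norm_num)] at hlog
    rw [posLog_of_ne hxy]
    exact (ENNReal.ofReal_le_ofReal (by linarith)).trans ENNReal.ofReal_add_le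
  rw [← add_assoc]
  rcases le_or_gt (4 * η) |x - y| with hfar | hnear
  · refine (posEnergy_smoothingKernel_le_posLog_add (ε := 1 / 2) (by linarith) (by norm_num) le_rfl
      hxy (by nlinarith)).trans (add_le_add (hscale _ (by nlinarith) (by nlinarith)) ?_)
    norm_num
  · refine (posEnergy_uniformInterval_le _ _ hη₀ η).trans ?_
    gcongr
    exact hscale η hη₀ (by linarith)

lemma limsup_posEnergy_smoothingKernel_le {η : ℕ → ℝ} (hη : Tendsto η atTop (𝓝[>] 0)) (x y : ℝ) :
    limsup (fun n => posEnergy (smoothingKernel (η n) x) (smoothingKernel (η n) y)) atTop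
      ≤ posLog x y := by
  rcases eq_or_ne x y with rfl | hxy
  · simp only [posLog_self, le_top]
  have hd : 0 < |x - y| := abs_pos.2 (sub_ne_zero.2 hxy)
  have hη₀ : Tendsto η atTop (𝓝 0) := hη.mono_right nhdsWithin_le_nhds
  have hdist : Tendsto (fun n => (1 - η n) * |x - y|) atTop (𝓝 |x - y|) := by
    simpa only [sub_zero, one_mul] using (hη₀.const_sub 1).mul_const |x - y|
  have hε : Tendsto (fun n => η n / ((1 - η n) * |x - y|)) atTop (𝓝 0) := by
    rw [← zero_div |x - y|]
    exact hη₀.div hdist hd.ne'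
  have hlim : Tendsto (fun n => ENNReal.ofReal (-Real.log ((1 - η n) * |x - y|))
      + ENNReal.ofReal (2 * (η n / ((1 - η n) * |x - y|)))) atTop (𝓝 (posLog x y)) := by
    rw [posLog_of_ne hxy]
    simpa only [mul_zero, ENNReal.ofReal_zero, add_zero] using
      (ENNReal.tendsto_ofReal ((hdist.log hd.ne').neg)).add
        (ENNReal.tendsto_ofReal (hε.const_mul 2))
  refine (limsup_le_limsup ?_).trans_eq hlim.limsup_eq
  filter_upwards [hη.eventually self_mem_nhdsWithin, hη₀.eventually (gt_mem_nhds one_pos),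
    hε.eventually (ge_mem_nhds one_half_pos)] with n hpos hlt hle
  have hpos' : 0 < (1 - η n) * |x - y| := mul_pos (by linarith) hd
  exact posEnergy_smoothingKernel_le_posLog_add hlt (div_nonneg (le_of_lt hpos) hpos'.le) hle hxy
    (div_mul_cancel₀ _ hpos'.ne').ge

lemma exists_posEnergy_bind_smoothingKernel_lt (ν : Measure ℝ) [IsFiniteMeasure ν] {B : ℝ≥0∞}
    (hB : posEnergy ν ν < B) :
    ∃ η ∈ Ioc (0 : ℝ) (1 / 2),
      posEnergy (ν.bind (smoothingKernel η)) (ν.bind (smoothingKernel η)) < B := by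
  set η : ℕ → ℝ := fun n => 1 / ((n + 1 : ℕ) + 1 : ℝ)
  have hη₀ : ∀ n, 0 < η n := fun n => Nat.one_div_pos_of_nat
  have hη₂ : ∀ n, η n ≤ 1 / 2 := fun n =>
    one_div_le_one_div_of_le two_pos (by push_cast; linarith [Nat.cast_nonneg (α := ℝ) n])
  have hη : Tendsto η atTop (𝓝[>] 0) := tendsto_nhdsWithin_iff.2
    ⟨(tendsto_add_atTop_iff_nat 1).2 (tendsto_one_div_add_atTop_nhds_zero_nat (𝕜 := ℝ)),
      Eventually.of_forall hη₀⟩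
  have hfin : ∫⁻ p, posLog p.1 p.2 + (ENNReal.ofReal (Real.log 4) + 2) ∂(ν.prod ν) ≠ ∞ := by
    rw [lintegral_add_right _ measurable_const, ← posEnergy_eq_lintegral_prod, lintegral_const]
    exact ENNReal.add_ne_top.2 ⟨hB.ne_top, ENNReal.mul_ne_top (by finiteness) (by finiteness)⟩
  have hlimsup : limsup (fun n => ∫⁻ p, posEnergy (smoothingKernel (η n) p.1)
      (smoothingKernel (η n) p.2) ∂(ν.prod ν)) atTop < B := by
    refine lt_of_le_of_lt ?_ hB
    rw [posEnergy_eq_lintegral_prod]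
    exact (limsup_lintegral_le _ (fun n => measurable_posEnergy_kernel (smoothingKernel (η n)))
      (fun n => Eventually.of_forall fun p =>
        posEnergy_smoothingKernel_le (hη₀ n) (hη₂ n) p.1 p.2) hfin).trans
      (lintegral_mono fun p => limsup_posEnergy_smoothingKernel_le hη p.1 p.2)
  obtain ⟨n, hn⟩ := (eventually_lt_of_limsup_lt hlimsup).exists
  refine ⟨η n, ⟨hη₀ n, hη₂ n⟩, ?_⟩
  rwa [posEnergy_bind]

lemma exists_absolutelyContinuous_posEnergy_lt (ν : Measure ℝ) [IsProbabilityMeasure ν]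
    (hν : ν (Icc 0 1)ᶜ = 0) {B : ℝ≥0∞} (hB : posEnergy ν ν < B) :
    ∃ ν' : Measure ℝ, IsProbabilityMeasure ν' ∧ ν' ≪ volume ∧ ν' (Ioo 0 1)ᶜ = 0 ∧
      posEnergy ν' ν' < B := by
  obtain ⟨η, ⟨hη₀, hη₂⟩, hη⟩ := exists_posEnergy_bind_smoothingKernel_lt ν hB
  have hmarkov : IsMarkovKernel (smoothingKernel η) := isMarkovKernel_uniformKernel _ _ fun _ => hη₀
  refine ⟨ν.bind (smoothingKernel η), inferInstance,
    bind_uniformKernel_absolutelyContinuous _ _ ν, ?_, hη⟩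
  refine bind_uniformKernel_compl_eq_zero _ _ measurableSet_Ioo ?_
  filter_upwards [show ∀ᵐ x ∂ν, x ∈ Icc (0 : ℝ) 1 from hν] with x hx
  have hη₁ : 0 ≤ 1 - η := by linarith
  exact Ioo_subset_Ioo (by nlinarith [hx.1]) (by nlinarith [hx.2])

end Smoothing

/-! ### Weak limits -/

section WeakLimits

variable {X : Type*} [PseudoEMetricSpace X]

/-- The truncated kernel `min (log⁺ (1 / |x - y|)) T`, to which weak convergence applies. -/
def truncLog (T : ℝ≥0) : X × X →ᵇ ℝ≥0 :=
  .mkOfBound ⟨fun p => (min (posLog p.1 p.2) T).toNNReal,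
    ENNReal.continuousOn_toNNReal.comp_continuous (continuous_posLog.min continuous_const)
      fun _ => ne_top_of_le_ne_top ENNReal.coe_ne_top (min_le_right _ _)⟩ T fun p p' => by
    have hle : ∀ p : X × X, (min (posLog p.1 p.2) T).toNNReal ≤ T := fun p =>
      ENNReal.coe_le_coe.1 (ENNReal.coe_toNNReal_le_self.trans (min_le_right _ _))
    exact abs_sub_le_of_nonneg_of_le (NNReal.coe_nonneg _) (hle p) (NNReal.coe_nonneg _) (hle p')

lemma coe_truncLog (T : ℝ≥0) (p : X × X) : (truncLog T p : ℝ≥0∞) = min (posLog p.1 p.2) T :=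
  ENNReal.coe_toNNReal (ne_top_of_le_ne_top ENNReal.coe_ne_top (min_le_right _ _))

lemma truncLog_le_posLog (T : ℝ≥0) (p : X × X) : (truncLog T p : ℝ≥0∞) ≤ posLog p.1 p.2 :=
  (coe_truncLog T p).trans_le (min_le_left _ _)

lemma truncLog_le (T : ℝ≥0) (p : X × X) : (truncLog T p : ℝ≥0∞) ≤ T :=
  (coe_truncLog T p).trans_le (min_le_right _ _)

lemma iSup_min_natCast (a : ℝ≥0∞) : ⨆ n : ℕ, min a n = a := by
  rw [← inf_iSup_eq, ENNReal.iSup_natCast, inf_top_eq]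

variable [MeasurableSpace X] [OpensMeasurableSpace X] [SecondCountableTopology X]

lemma posEnergy_le_of_forall_lintegral_truncLog_le {μ : Measure X} [SFinite μ] {B : ℝ≥0∞}
    (h : ∀ T : ℕ, ∫⁻ p, truncLog T p ∂(μ.prod μ) ≤ B) : posEnergy μ μ ≤ B := by
  have hsup : ∫⁻ p, posLog p.1 p.2 ∂(μ.prod μ)
      = ∫⁻ p, ⨆ T : ℕ, min (posLog p.1 p.2) T ∂(μ.prod μ) :=
    lintegral_congr fun p => (iSup_min_natCast _).symm
  rw [posEnergy_eq_lintegral_prod, hsup,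
    lintegral_iSup fun T => measurable_posLog.min measurable_const]
  · exact iSup_le fun T => by simpa only [coe_truncLog, ENNReal.coe_natCast] using h T
  · exact fun S T hST p => min_le_min_left _ (Nat.cast_le.2 hST)

variable {ι : Type*} {L : Filter ι} {ν : ι → ProbabilityMeasure X} {μ : ProbabilityMeasure X}

lemma tendsto_lintegral_mul_mul_truncLog (h : Tendsto ν L (𝓝 μ)) (g : X →ᵇ ℝ≥0) (T : ℝ≥0) :
    Tendsto (fun i => ∫⁻ p, g p.1 * g p.2 * truncLog T p ∂((ν i : Measure X).prod (ν i))) L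
      (𝓝 (∫⁻ p, g p.1 * g p.2 * truncLog T p ∂((μ : Measure X).prod μ))) := by
  have hprod : Tendsto (fun i => (ν i).prod (ν i)) L (𝓝 (μ.prod μ)) :=
    (ProbabilityMeasure.continuous_prod.tendsto (μ, μ)).comp (h.prodMk_nhds h)
  let F : X × X →ᵇ ℝ≥0 := g.compContinuous ⟨Prod.fst, continuous_fst⟩ *
    g.compContinuous ⟨Prod.snd, continuous_snd⟩ * truncLog T
  have hF : ∀ p, (F p : ℝ≥0∞) = g p.1 * g p.2 * truncLog T p := fun p => by
    simp only [F, BoundedContinuousFunction.mul_apply,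
      BoundedContinuousFunction.compContinuous_apply, ContinuousMap.coe_mk, ENNReal.coe_mul]
  simpa only [hF, ProbabilityMeasure.toMeasure_prod] using
    ProbabilityMeasure.tendsto_iff_forall_lintegral_tendsto.1 hprod F

lemma posEnergy_le_of_tendsto [L.NeBot] (h : Tendsto ν L (𝓝 μ)) {B : ℝ≥0∞}
    (hB : ∀ i, posEnergy (ν i : Measure X) (ν i) ≤ B) : posEnergy (μ : Measure X) μ ≤ B := by
  refine posEnergy_le_of_forall_lintegral_truncLog_le fun T => ?_
  have hlim := tendsto_lintegral_mul_mul_truncLog h 1 T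
  simp only [BoundedContinuousFunction.coe_one, Pi.one_apply, ENNReal.coe_one, one_mul] at hlim
  exact le_of_tendsto hlim (Eventually.of_forall fun i =>
    (lintegral_mono fun p => truncLog_le_posLog T p).trans
      ((posEnergy_eq_lintegral_prod _ _).ge.trans (hB i)))

end WeakLimits

section NestedSupports

variable {X : Type*} [TopologicalSpace X] [MeasurableSpace X] [BorelSpace X]

lemma exists_tendsto_hyperfilter_probabilityMeasure [T2Space X] {K : Set X} (hK : IsCompact K)
    {ν : ℕ → ProbabilityMeasure X} (hν : ∀ n, (ν n : Measure X) Kᶜ = 0) :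
    ∃ μ, Tendsto ν (hyperfilter ℕ) (𝓝 μ) := by
  have hcompact := isCompact_setOfPred_probabilityMeasure_mass_eq_compl_isCompact_le
    (u := fun _ : ℕ => 0) (K := fun _ => K) tendsto_const_nhds (fun _ => hK) (Or.inr monotone_const)
  have hmem : ∀ n, ν n ∈ {μ : ProbabilityMeasure X | ∀ _ : ℕ, μ Kᶜ ≤ 0} := fun n _ => by
    rw [nonpos_iff_eq_zero, ProbabilityMeasure.null_iff_toMeasure_null]
    exact hν n
  obtain ⟨μ, -, hμ⟩ := hcompact.ultrafilter_le_nhds ((hyperfilter ℕ).map ν)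
    (tendsto_principal.2 (Eventually.of_forall hmem))
  exact ⟨μ, hμ⟩

lemma measure_compl_eq_zero_of_tendsto [HasOuterApproxClosed X] {ι : Type*} {L : Filter ι}
    [L.NeBot] {ν : ι → ProbabilityMeasure X} {μ : ProbabilityMeasure X} (h : Tendsto ν L (𝓝 μ))
    {C : Set X} (hC : IsClosed C) (hν : ∀ᶠ i in L, (ν i : Measure X) Cᶜ = 0) :
    (μ : Measure X) Cᶜ = 0 := by
  have hlim : Tendsto (fun i => (ν i : Measure X) Cᶜ) L (𝓝 0) :=
    tendsto_const_nhds.congr' (hν.mono fun _ hi => hi.symm)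
  exact nonpos_iff_eq_zero.1
    ((ProbabilityMeasure.le_liminf_measure_open_of_tendsto h hC.isOpen_compl).trans_eq
      hlim.liminf_eq)

end NestedSupports

lemma exists_measure_iInter_of_nested {X : Type*} [EMetricSpace X] [SecondCountableTopology X]
    [MeasurableSpace X] [BorelSpace X] {B : ℝ≥0∞} {U : ℕ → Set X} {ν : ℕ → Measure X}
    (hcompact : IsCompact (closure (U 0))) (hU : ∀ j, closure (U (j + 1)) ⊆ U j)
    (hν : ∀ j, IsProbabilityMeasure (ν j)) (hνU : ∀ j, ν j (U j)ᶜ = 0)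
    (hB : ∀ j, posEnergy (ν j) (ν j) ≤ B) :
    ∃ μ : Measure X, IsProbabilityMeasure μ ∧ μ (⋂ j, closure (U j))ᶜ = 0 ∧ posEnergy μ μ ≤ B := by
  have hanti : Antitone U := antitone_nat_of_succ_le fun j => subset_closure.trans (hU j)
  have hν_closure : ∀ {i j}, j ≤ i → ν i (closure (U j))ᶜ = 0 := fun {i _} hij =>
    measure_mono_null (compl_subset_compl.2 ((hanti hij).trans subset_closure)) (hνU i)
  obtain ⟨μ, hμ⟩ := exists_tendsto_hyperfilter_probabilityMeasure hcompact
    (ν := fun j => ⟨ν j, hν j⟩) fun j => hν_closure (Nat.zero_le j)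
  refine ⟨μ, inferInstance, ?_, posEnergy_le_of_tendsto hμ hB⟩
  rw [compl_iInter]
  exact measure_iUnion_null fun j => measure_compl_eq_zero_of_tendsto hμ isClosed_closure
    (Nat.hyperfilter_le_atTop (mem_of_superset (Ici_mem_atTop j) fun _ => hν_closure))

section Density

variable {X : Type*} [PseudoEMetricSpace X] [MeasurableSpace X] [BorelSpace X] {P : Measure X}

lemma exists_bounded_density_withDensity_le {ν : Measure X} [IsProbabilityMeasure ν]
    [ν.InnerRegularCompactLTTop] [ν.HaveLebesgueDecomposition P] [T2Space X] (hνP : ν ≪ P)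
    {U : Set X} (hU : IsOpen U) (hνU : ν Uᶜ = 0) {r : ℝ≥0∞} (hr : r < 1) :
    ∃ (M : ℝ≥0) (K : Set X) (F : X → ℝ≥0), IsCompact K ∧ K ⊆ U ∧ Measurable F ∧ (∀ x, F x ≤ M) ∧
      (∀ x ∉ K, F x = 0) ∧ r < ∫⁻ x, F x ∂P ∧ P.withDensity (fun x => F x) ≤ ν := by
  have hνU_eq : ν U = 1 := (prob_compl_eq_zero_iff hU.measurableSet).1 hνU
  obtain ⟨K, hKU, hK, hrK⟩ := hU.exists_lt_isCompact (μ := ν) (r := r) (by rwa [hνU_eq])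
  have hρ : Measurable (ν.rnDeriv P) := Measure.measurable_rnDeriv ν P
  have hν : P.withDensity (ν.rnDeriv P) = ν := Measure.withDensity_rnDeriv_eq ν P hνP
  have hsup : ⨆ n : ℕ, ∫⁻ x in K, min (ν.rnDeriv P x) n ∂P = ν K := by
    rw [← lintegral_iSup (fun n => hρ.min measurable_const)
      fun m n hmn x => min_le_min_left _ (Nat.cast_le.2 hmn)]
    simp only [iSup_min_natCast]
    rw [← withDensity_apply _ hK.measurableSet, hν]
  obtain ⟨n, hn⟩ := lt_iSup_iff.1 (hsup.symm ▸ hrK)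
  set F : X → ℝ≥0 := K.indicator fun x => (min (ν.rnDeriv P x) n).toNNReal
  have hF : ∀ x, (F x : ℝ≥0∞) = K.indicator (fun x => min (ν.rnDeriv P x) n) x := fun x => by
    rw [ENNReal.coe_indicator]
    congr! with x
    exact ENNReal.coe_toNNReal (ne_top_of_le_ne_top (ENNReal.natCast_ne_top n) (min_le_right _ _))
  have hF_le : ∀ x, (F x : ℝ≥0∞) ≤ min (ν.rnDeriv P x) n := fun x =>
    (hF x).trans_le (indicator_le_self _ _ x)
  refine ⟨n, K, F, hK, hKU, (hρ.min measurable_const).ennreal_toNNReal.indicator hK.measurableSet,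
    fun x => by exact_mod_cast (hF_le x).trans (min_le_right _ _),
    fun x hx => indicator_of_notMem hx _, ?_, ?_⟩
  · simp only [hF]
    rwa [lintegral_indicator hK.measurableSet]
  · conv_rhs => rw [← hν]
    exact withDensity_mono (Eventually.of_forall fun x => (hF_le x).trans (min_le_left _ _))

lemma exists_boundedContinuous_ae_tendsto [NormalSpace X] [P.WeaklyRegular] {f : X → ℝ}
    (hf : Integrable f P) :
    ∃ h : ℕ → X →ᵇ ℝ, ∀ᵐ x ∂P, Tendsto (fun n => h n x) atTop (𝓝 (f x)) := by
  have happrox : ∀ n : ℕ, ∃ h : X →ᵇ ℝ, eLpNorm (f - ⇑h) 1 P ≤ (n : ℝ≥0∞)⁻¹ ∧ MemLp h 1 P :=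
    fun n => (memLp_one_iff_integrable.2 hf).exists_boundedContinuous_eLpNorm_sub_le
      ENNReal.one_ne_top
      (ENNReal.inv_ne_zero.2 (ENNReal.natCast_ne_top n))
  choose h hh hmem using happrox
  have hmeas : TendstoInMeasure P (fun n => h n) atTop f := by
    refine tendstoInMeasure_of_tendsto_eLpNorm one_ne_zero (fun n => (hmem n).1) hf.1 ?_
    refine tendsto_of_tendsto_of_tendsto_of_le_of_le tendsto_const_nhds
      ENNReal.tendsto_inv_nat_nhds_zero (fun _ => zero_le) fun n => ?_
    rw [eLpNorm_sub_comm]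
    exact hh n
  obtain ⟨ns, -, hns⟩ := hmeas.exists_seq_tendsto_ae
  exact ⟨fun n => h (ns n), hns⟩

lemma exists_boundedContinuous_compactSupport_ae_tendsto [LocallyCompactSpace X] [NormalSpace X]
    [P.WeaklyRegular] [IsFiniteMeasure P] {M : ℝ≥0} {K U : Set X} {F : X → ℝ≥0} (hK : IsCompact K)
    (hU : IsOpen U) (hKU : K ⊆ U) (hF : Measurable F) (hFM : ∀ x, F x ≤ M)
    (hFK : ∀ x ∉ K, F x = 0) :
    ∃ (g : ℕ → X →ᵇ ℝ≥0) (K' : Set X), IsCompact K' ∧ K' ⊆ U ∧ (∀ n x, g n x ≤ M) ∧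
      (∀ n, ∀ x ∉ K', g n x = 0) ∧ ∀ᵐ x ∂P, Tendsto (fun n => g n x) atTop (𝓝 (F x)) := by
  have hint : Integrable (fun x => (F x : ℝ)) P :=
    Integrable.of_bound hF.coe_nnreal_real.aestronglyMeasurable M
      (Eventually.of_forall fun x => (Real.norm_of_nonneg (F x).2).trans_le (hFM x))
  obtain ⟨h, hh⟩ := exists_boundedContinuous_ae_tendsto hint
  obtain ⟨K', hK', hKK', hK'U⟩ := exists_compact_between hK hU hKU
  obtain ⟨χ, hχ_one, hχ_zero, -, hχ⟩ := exists_continuous_one_zero_of_isCompact hK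
    (isOpen_interior (s := K')).isClosed_compl (disjoint_compl_right_iff_subset.2 hKK')
  let χ' : X →ᵇ ℝ := .ofNormedAddCommGroup χ χ.continuous 1 fun x => by
    rw [Real.norm_of_nonneg (hχ x).1]
    exact (hχ x).2
  let g : ℕ → X →ᵇ ℝ≥0 := fun n => ((χ' * h n) ⊓ .const X (M : ℝ)).nnrealPart
  have hg : ∀ n x, g n x = (min (χ x * h n x) M).toNNReal := fun n x => rfl
  refine ⟨g, K', hK', hK'U, fun n x => ?_, fun n x hx => ?_, ?_⟩
  · rw [hg, Real.toNNReal_le_iff_le_coe]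
    exact min_le_right _ _
  · have hx' : χ x = 0 := hχ_zero fun hx' => hx (interior_subset hx')
    simp [hg, hx']
  · filter_upwards [hh] with x hx
    have hχF : χ x * F x = F x := by
      by_cases hxK : x ∈ K
      · rw [hχ_one hxK, Pi.one_apply, one_mul]
      · rw [hFK x hxK, NNReal.coe_zero, mul_zero]
    have hlim : Tendsto (fun n => (min (χ x * h n x) M).toNNReal) atTop
        (𝓝 (min (χ x * F x) M).toNNReal) :=
      (continuous_real_toNNReal.tendsto _).comp ((hx.const_mul (χ x)).min tendsto_const_nhds)
    rwa [hχF, min_eq_left (NNReal.coe_le_coe.2 (hFM x)), Real.toNNReal_coe] at hlim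

lemma tendsto_posEnergy_withDensity [SecondCountableTopology X] [SFinite P]
    (hP : posEnergy P P ≠ ∞) {M : ℝ≥0} {F : X → ℝ≥0} {g : ℕ → X → ℝ≥0} (hF : Measurable F)
    (hg : ∀ n, Measurable (g n)) (hgM : ∀ n x, g n x ≤ M)
    (h : ∀ᵐ x ∂P, Tendsto (fun n => g n x) atTop (𝓝 (F x))) :
    Tendsto (fun n => posEnergy (P.withDensity fun x => g n x) (P.withDensity fun x => g n x)) atTop
      (𝓝 (posEnergy (P.withDensity fun x => F x) (P.withDensity fun x => F x))) := by
  simp only [posEnergy_withDensity hF.coe_nnreal_ennreal,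
    fun n => posEnergy_withDensity (hg n).coe_nnreal_ennreal]
  have hfin : ∫⁻ p, M * M * posLog p.1 p.2 ∂(P.prod P) ≠ ∞ := by
    rw [lintegral_const_mul _ measurable_posLog, ← posEnergy_eq_lintegral_prod]
    exact ENNReal.mul_ne_top (by finiteness) hP
  refine tendsto_lintegral_of_dominated_convergence _ (fun n => ?_) (fun n =>
    Eventually.of_forall fun p => ?_) hfin ?_
  · exact (((hg n).comp measurable_fst).coe_nnreal_ennreal.mul
      ((hg n).comp measurable_snd).coe_nnreal_ennreal).mul measurable_posLog
  · exact mul_le_mul' (mul_le_mul' (ENNReal.coe_le_coe.2 (hgM n p.1))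
      (ENNReal.coe_le_coe.2 (hgM n p.2))) le_rfl
  · have hlt : ∀ᵐ p ∂(P.prod P), posLog p.1 p.2 < ∞ := by
      refine ae_lt_top measurable_posLog ?_
      rwa [← posEnergy_eq_lintegral_prod]
    filter_upwards [hlt, Measure.quasiMeasurePreserving_fst.ae h,
      Measure.quasiMeasurePreserving_snd.ae h] with p hp hfst hsnd
    exact ENNReal.Tendsto.mul_const (mod_cast hfst.mul hsnd) (Or.inr hp.ne)

lemma exists_boundedContinuous_posEnergy_withDensity_lt [T2Space X] [LocallyCompactSpace X]
    [SecondCountableTopology X] [IsFiniteMeasure P] (hP : posEnergy P P ≠ ∞) {ν : Measure X}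
    [IsProbabilityMeasure ν] (hνP : ν ≪ P) {U : Set X} (hU : IsOpen U) (hνU : ν Uᶜ = 0)
    {r E : ℝ≥0∞} (hr : r < 1) (hE : posEnergy ν ν < E) :
    ∃ (g : X →ᵇ ℝ≥0) (K : Set X), IsCompact K ∧ K ⊆ U ∧ (∀ x ∉ K, g x = 0) ∧ r < ∫⁻ x, g x ∂P ∧
      posEnergy (P.withDensity fun x => g x) (P.withDensity fun x => g x) < E := by
  obtain ⟨M, K, F, hK, hKU, hF, hFM, hFK, hrF, hFν⟩ :=
    exists_bounded_density_withDensity_le hνP hU hνU hr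
  obtain ⟨g, K', hK', hK'U, hgM, hgK', hg⟩ :=
    exists_boundedContinuous_compactSupport_ae_tendsto (P := P) hK hU hKU hF hFM hFK
  have hgm : ∀ n, Measurable (g n) := fun n => (g n).continuous.measurable
  have hmass : Tendsto (fun n => ∫⁻ x, g n x ∂P) atTop (𝓝 (∫⁻ x, F x ∂P)) := by
    refine tendsto_lintegral_of_dominated_convergence (fun _ => (M : ℝ≥0∞))
      (fun n => (hgm n).coe_nnreal_ennreal) (fun n => Eventually.of_forall fun x => ?_)
      (by simp [ENNReal.mul_eq_top]) (hg.mono fun x hx => ENNReal.tendsto_coe.2 hx)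
    exact ENNReal.coe_le_coe.2 (hgM n x)
  have henergy := tendsto_posEnergy_withDensity hP hF hgm hgM hg
  obtain ⟨n, hrn, hEn⟩ := ((hmass.eventually (lt_mem_nhds hrF)).and
    (henergy.eventually (gt_mem_nhds ((posEnergy_mono hFν hFν).trans_lt hE)))).exists
  exact ⟨g n, K', hK', hK'U, hgK' n, hrn, hEn⟩

end Density

/-! ### Sampling an energy at the centers -/

section Diagonal

variable {α : Type*} [MeasurableSpace α] [Countable α] [MeasurableSingletonClass α]

lemma lintegral_ite_diagonal (μ : Measure α) [SFinite μ] (f : α × α → ℝ≥0∞) [DecidableEq α] :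
    ∫⁻ p, (if p.1 = p.2 then f p else 0) ∂(μ.prod μ) = ∫⁻ x, μ {x} * f (x, x) ∂μ := by
  rw [lintegral_prod _ (measurable_of_countable _).aemeasurable]
  refine lintegral_congr fun x => ?_
  have hind : (fun y => if x = y then f (x, y) else 0) =
      ({x} : Set α).indicator fun _ => f (x, x) := by
    ext y
    by_cases hxy : x = y
    · simp [hxy]
    · simp [hxy, Ne.symm hxy]
  rw [hind, lintegral_indicator_const (measurableSet_singleton x), mul_comm]

lemma lintegral_mul_mul_prod_le_of_offDiag {μ : Measure α} [IsProbabilityMeasure μ] {A : Set α}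
    (hA : ∀ᵐ x ∂μ, x ∈ A) {w : α → ℝ≥0∞} {M : ℝ≥0∞} (hw : ∀ x, w x ≤ M) {f τ κ : α × α → ℝ≥0∞}
    {a b : ℝ≥0∞} (hoff : ∀ x ∈ A, ∀ y ∈ A, x ≠ y → f (x, y) ≤ τ (x, y) + κ (x, y) + a)
    (hdiag : ∀ x ∈ A, μ {x} * f (x, x) ≤ b) :
    ∫⁻ p, w p.1 * w p.2 * f p ∂(μ.prod μ)
      ≤ ∫⁻ p, w p.1 * w p.2 * τ p ∂(μ.prod μ) + M * M * (∫⁻ p, κ p ∂(μ.prod μ) + a + b) := by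
  classical
  have hpoint : ∀ᵐ p ∂(μ.prod μ), w p.1 * w p.2 * f p ≤ w p.1 * w p.2 * τ p
      + M * M * (κ p + a + if p.1 = p.2 then f p else 0) := by
    filter_upwards [Measure.quasiMeasurePreserving_fst.ae hA,
      Measure.quasiMeasurePreserving_snd.ae hA] with p h₁ h₂
    have hf : f p ≤ τ p + (κ p + a + if p.1 = p.2 then f p else 0) := by
      split_ifs with h
      · exact le_add_left le_add_self
      · rw [add_zero, ← add_assoc]
        exact hoff p.1 h₁ p.2 h₂ h
    calc w p.1 * w p.2 * f p
        ≤ w p.1 * w p.2 * (τ p + (κ p + a + if p.1 = p.2 then f p else 0)) := by gcongr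
      _ ≤ _ := by
          rw [mul_add]
          gcongr
          exacts [hw _, hw _]
  have hself : ∫⁻ p, (if p.1 = p.2 then f p else 0) ∂(μ.prod μ) ≤ b := by
    rw [lintegral_ite_diagonal]
    exact (lintegral_mono_ae (hA.mono hdiag)).trans (by simp)
  refine (lintegral_mono_ae hpoint).trans ?_
  rw [lintegral_add_left (measurable_of_countable _),
    lintegral_const_mul _ (measurable_of_countable _),
    lintegral_add_left (measurable_of_countable _), lintegral_add_left (measurable_of_countable _),
    lintegral_const, measure_univ, mul_one]
  gcongr

end Diagonal

open Classical in
/-- The kernel `log⁺ (1 / |c i - c j|)` restricted to the pairs of distinct indices whose centers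
are at distance less than `δ`. -/
def nearLog (c : ℕ → ℝ) (δ : ℝ) (p : ℕ × ℕ) : ℝ≥0∞ :=
  if p.1 ≠ p.2 ∧ |c p.1 - c p.2| < δ then posLog (c p.1) (c p.2) else 0

lemma posLog_le_truncLog_add_nearLog (c : ℕ → ℝ) {δ : ℝ} (hδ : 0 < δ) {i j : ℕ} (hij : i ≠ j) :
    posLog (c i) (c j) ≤ truncLog (-Real.log δ).toNNReal (c i, c j) + nearLog c δ (i, j) := by
  rcases lt_or_ge |c i - c j| δ with h | h
  · exact le_add_left (if_pos ⟨hij, h⟩).ge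
  · rw [coe_truncLog]
    exact le_add_right (le_min le_rfl (posLog_le_of_le_abs_sub hδ h))

/-- The indices drawn from the laws `m n`, carried by the finite sets `A n`, sample the measure `P`
through the centers `c`: the laws of the centers converge weakly to `P`, and neither pairs of close
centers nor single intervals of length `l i` contribute to the limiting energy. -/
structure IsSampling (c l : ℕ → ℝ) (P : ProbabilityMeasure ℝ) (m : ℕ → ProbabilityMeasure ℕ)
    (A : ℕ → Finset ℕ) : Prop where
  tendsto_map : Tendsto (fun n => (m n).map (f := c) (measurable_of_countable c).aemeasurable) atTop
    (𝓝 P)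
  ae_mem : ∀ n, ∀ᵐ i ∂(m n : Measure ℕ), i ∈ A n
  eventually_le : ∀ k, ∀ᶠ n in atTop, ∀ i ∈ A n, k ≤ i
  near : ∀ ε : ℝ≥0, 0 < ε → ∃ δ > 0, ∀ᶠ n in atTop,
    ∫⁻ p, nearLog c δ p ∂((m n : Measure ℕ).prod (m n)) ≤ ε
  separated : ∀ ε : ℝ, 0 < ε → ∀ᶠ n in atTop, ∀ i ∈ A n, ∀ j ∈ A n, i ≠ j →
    c i ≠ c j ∧ (l i + l j) / 2 ≤ ε * |c i - c j|
  self : ∀ ε : ℝ≥0, 0 < ε → ∀ᶠ n in atTop, ∀ i ∈ A n,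
    (m n : Measure ℕ) {i} * (1 + ENNReal.ofReal (-Real.log (l i))) ≤ ε

/-- The density `g` sampled by the centers with weights `m`, each point mass being spread over the
concentric half of its interval so that the closed support stays inside the open intervals. -/
def sampledMeasure (c l : ℕ → ℝ) (g : ℝ → ℝ≥0) (m : Measure ℕ) : Measure ℝ :=
  (m.withDensity fun i => g (c i)).bind
    (uniformKernel (measurable_of_countable c) (measurable_of_countable fun i => l i / 2))

section SampledMeasure

variable {c l : ℕ → ℝ} {g : ℝ → ℝ≥0} {m : Measure ℕ}

lemma sampledMeasure_univ (hl : ∀ k, 0 < l k) :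
    sampledMeasure c l g m univ = ∫⁻ i, g (c i) ∂m := by
  have := isMarkovKernel_uniformKernel (measurable_of_countable c)
    (measurable_of_countable fun i => l i / 2) fun k => half_pos (hl k)
  rw [sampledMeasure, Measure.comp_apply_univ, withDensity_apply _ .univ, Measure.restrict_univ]

lemma posEnergy_sampledMeasure [SFinite m] :
    posEnergy (sampledMeasure c l g m) (sampledMeasure c l g m)
      = ∫⁻ p, g (c p.1) * g (c p.2) * posEnergy (uniformInterval (c p.1) (l p.1 / 2))
          (uniformInterval (c p.2) (l p.2 / 2)) ∂(m.prod m) := by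
  rw [sampledMeasure, posEnergy_bind, prod_withDensity (measurable_of_countable _)
    (measurable_of_countable _),
    lintegral_withDensity_eq_lintegral_mul _ (measurable_of_countable _)
    (measurable_of_countable _)]
  rfl

lemma sampledMeasure_absolutelyContinuous [SFinite m] : sampledMeasure c l g m ≪ volume :=
  bind_uniformKernel_absolutelyContinuous _ _ _

lemma sampledMeasure_compl_eq_zero {S : Set ℝ} (hS : MeasurableSet S)
    (h : ∀ᵐ i ∂m, g (c i) ≠ 0 → Ioo (c i - l i / 2 / 2) (c i + l i / 2 / 2) ⊆ S) :
    sampledMeasure c l g m Sᶜ = 0 := by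
  refine bind_uniformKernel_compl_eq_zero _ _ hS ?_
  rw [ae_withDensity_iff (measurable_of_countable _)]
  exact h.mono fun i hi hgi => hi (ENNReal.coe_ne_zero.1 hgi)

end SampledMeasure

lemma posEnergy_uniformInterval_half_le (c : ℝ) {ℓ : ℝ} (hℓ : 0 < ℓ) :
    posEnergy (uniformInterval c (ℓ / 2)) (uniformInterval c (ℓ / 2))
      ≤ 3 * (1 + ENNReal.ofReal (-Real.log ℓ)) := by
  have hlog : ENNReal.ofReal (-Real.log (ℓ / 2)) ≤ 1 + ENNReal.ofReal (-Real.log ℓ) := by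
    rw [← ENNReal.ofReal_one, Real.log_div hℓ.ne' two_ne_zero]
    refine (ENNReal.ofReal_le_ofReal ?_).trans ENNReal.ofReal_add_le
    linarith [Real.log_two_lt_d9]
  calc posEnergy (uniformInterval c (ℓ / 2)) (uniformInterval c (ℓ / 2))
      ≤ ENNReal.ofReal (-Real.log (ℓ / 2)) + 2 :=
        posEnergy_uniformInterval_le c c (half_pos hℓ) (ℓ / 2)
    _ ≤ 1 + ENNReal.ofReal (-Real.log ℓ) + 2 * (1 + ENNReal.ofReal (-Real.log ℓ)) := by
        gcongr
        rw [mul_add, mul_one]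
        exact le_self_add
    _ = 3 * (1 + ENNReal.ofReal (-Real.log ℓ)) := by ring

namespace IsSampling

variable {c l : ℕ → ℝ} {P : ProbabilityMeasure ℝ} {m : ℕ → ProbabilityMeasure ℕ} {A : ℕ → Finset ℕ}
  (h : IsSampling c l P m A)

include h

lemma tendsto_lintegral (g : ℝ →ᵇ ℝ≥0) :
    Tendsto (fun n => ∫⁻ i, g (c i) ∂(m n : Measure ℕ)) atTop
      (𝓝 (∫⁻ x, g x ∂(P : Measure ℝ))) := by
  refine (ProbabilityMeasure.tendsto_iff_forall_lintegral_tendsto.1 h.tendsto_map g).congr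
    fun n => ?_
  exact lintegral_map g.continuous.measurable.coe_nnreal_ennreal (measurable_of_countable c)

lemma tendsto_lintegral_truncLog (g : ℝ →ᵇ ℝ≥0) (T : ℝ≥0) :
    Tendsto (fun n => ∫⁻ p, g (c p.1) * g (c p.2) * truncLog T (c p.1, c p.2)
        ∂((m n : Measure ℕ).prod (m n))) atTop
      (𝓝 (∫⁻ p, g p.1 * g p.2 * truncLog T p ∂((P : Measure ℝ).prod P))) := by
  have hc : Measurable c := measurable_of_countable c
  have hg : Measurable g := g.continuous.measurable
  refine (tendsto_lintegral_mul_mul_truncLog h.tendsto_map g T).congr fun n => ?_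
  have hmap := Measure.map_prod_map (m n : Measure ℕ) (m n : Measure ℕ) hc hc
  simp only [ProbabilityMeasure.toMeasure_map]
  rw [hmap, lintegral_map _ (by fun_prop)]
  · rfl
  · exact ((hg.comp measurable_fst).coe_nnreal_ennreal.mul
      (hg.comp measurable_snd).coe_nnreal_ennreal).mul
      (truncLog T).continuous.measurable.coe_nnreal_ennreal

lemma posEnergy_ne_top : posEnergy (P : Measure ℝ) P ≠ ∞ := by
  obtain ⟨δ, hδ, hnear⟩ := h.near 1 one_pos
  set D := (-Real.log δ).toNNReal
  suffices hle : ∀ T : ℕ, ∫⁻ p, truncLog T p ∂((P : Measure ℝ).prod P) ≤ D + (1 + 0 + 1) from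
    ne_top_of_le_ne_top (by finiteness) (posEnergy_le_of_forall_lintegral_truncLog_le hle)
  intro T
  have hlim := h.tendsto_lintegral_truncLog 1 T
  simp only [BoundedContinuousFunction.coe_one, Pi.one_apply, ENNReal.coe_one, one_mul] at hlim
  refine le_of_tendsto hlim ?_
  filter_upwards [hnear, h.self (T + 1 : ℝ≥0)⁻¹ (by positivity)] with n hn hself
  have hoff : ∀ i ∈ A n, ∀ j ∈ A n, i ≠ j →
      (truncLog T (c i, c j) : ℝ≥0∞) ≤ D + nearLog c δ (i, j) + 0 := fun i _ j _ hij =>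
    calc (truncLog T (c i, c j) : ℝ≥0∞) ≤ posLog (c i) (c j) := truncLog_le_posLog T _
      _ ≤ truncLog D (c i, c j) + nearLog c δ (i, j) := posLog_le_truncLog_add_nearLog c hδ hij
      _ ≤ D + nearLog c δ (i, j) + 0 := by
          rw [add_zero]
          exact add_le_add (truncLog_le D _) le_rfl
  have hdiag : ∀ i ∈ A n, (m n : Measure ℕ) {i} * truncLog T (c i, c i) ≤ 1 := fun i hi =>
    calc (m n : Measure ℕ) {i} * truncLog T (c i, c i)
        ≤ ((T + 1 : ℝ≥0)⁻¹ : ℝ≥0) * (T + 1 : ℝ≥0) :=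
          mul_le_mul' ((le_mul_of_one_le_right' le_self_add).trans (hself i hi))
            ((truncLog_le T _).trans (ENNReal.coe_le_coe.2 le_self_add))
      _ = 1 := by rw [← ENNReal.coe_mul, inv_mul_cancel₀ (by positivity), ENNReal.coe_one]
  have hsplit := lintegral_mul_mul_prod_le_of_offDiag (h.ae_mem n) (w := 1) (fun _ => le_rfl)
    (f := fun p => truncLog T (c p.1, c p.2)) (τ := fun _ => D) hoff hdiag
  simp only [Pi.one_apply, one_mul, lintegral_const, measure_univ, mul_one] at hsplit
  exact hsplit.trans (by gcongr; simpa using hn)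

lemma eventually_posEnergy_uniformInterval_le (hl : ∀ k, 0 < l k) {ε : ℝ≥0} (hε : 0 < ε) :
    ∀ᶠ n in atTop, ∀ i ∈ A n, ∀ j ∈ A n, i ≠ j →
      posEnergy (uniformInterval (c i) (l i / 2)) (uniformInterval (c j) (l j / 2))
        ≤ posLog (c i) (c j) + ε := by
  set η : ℝ := min (ε / 2) (1 / 2)
  have hη : 0 < η := lt_min (by positivity) (by norm_num)
  have hηε : ENNReal.ofReal (2 * η) ≤ ε := by
    rw [← ENNReal.ofReal_coe_nnreal]
    exact ENNReal.ofReal_le_ofReal (by linarith [min_le_left ((ε : ℝ) / 2) (1 / 2)])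
  filter_upwards [h.separated η hη] with n hn i hi j hj hij
  obtain ⟨hc, hle⟩ := hn i hi j hj hij
  refine (posEnergy_uniformInterval_le_posLog_add hη.le (min_le_right _ _) hc ?_).trans
    (add_le_add le_rfl hηε)
  linarith [hl i, hl j]

lemma eventually_mul_posEnergy_uniformInterval_self_le (hl : ∀ k, 0 < l k) {ε : ℝ≥0}
    (hε : 0 < ε) :
    ∀ᶠ n in atTop, ∀ i ∈ A n, (m n : Measure ℕ) {i} *
      posEnergy (uniformInterval (c i) (l i / 2)) (uniformInterval (c i) (l i / 2)) ≤ ε := by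
  filter_upwards [h.self (ε / 3) (by positivity)] with n hn i hi
  calc (m n : Measure ℕ) {i} *
        posEnergy (uniformInterval (c i) (l i / 2)) (uniformInterval (c i) (l i / 2))
      ≤ (m n : Measure ℕ) {i} * (3 * (1 + ENNReal.ofReal (-Real.log (l i)))) := by
        gcongr
        exact posEnergy_uniformInterval_half_le (c i) (hl i)
    _ ≤ 3 * (ε / 3 : ℝ≥0) := by
        rw [mul_left_comm]
        gcongr
        exact hn i hi
    _ = ε := mod_cast congrArg ENNReal.ofNNReal (mul_div_cancel₀ ε three_ne_zero)

lemma exists_eventually_posEnergy_sampledMeasure_le (hl : ∀ k, 0 < l k) (g : ℝ →ᵇ ℝ≥0) {ε : ℝ≥0}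
    (hε : 0 < ε) :
    ∃ T : ℝ≥0, ∀ᶠ n in atTop, posEnergy (sampledMeasure c l g (m n)) (sampledMeasure c l g (m n))
      ≤ ∫⁻ p, g (c p.1) * g (c p.2) * truncLog T (c p.1, c p.2) ∂((m n : Measure ℕ).prod (m n))
        + nndist g 0 * nndist g 0 * ε := by
  have hε₃ : 0 < ε / 3 := by positivity
  obtain ⟨δ, hδ, hnear⟩ := h.near (ε / 3) hε₃
  refine ⟨(-Real.log δ).toNNReal, ?_⟩
  filter_upwards [hnear, h.eventually_posEnergy_uniformInterval_le hl hε₃,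
    h.eventually_mul_posEnergy_uniformInterval_self_le hl hε₃] with n hn hoff hself
  have hsplit := lintegral_mul_mul_prod_le_of_offDiag (h.ae_mem n) (w := fun i => g (c i))
    (fun i => ENNReal.coe_le_coe.2 (BoundedContinuousFunction.NNReal.upper_bound g _))
    (f := fun p => posEnergy (uniformInterval (c p.1) (l p.1 / 2))
      (uniformInterval (c p.2) (l p.2 / 2)))
    (τ := fun p => truncLog (-Real.log δ).toNNReal (c p.1, c p.2)) (κ := nearLog c δ)
    (fun i hi j hj hij => (hoff i hi j hj hij).trans
      (add_le_add (posLog_le_truncLog_add_nearLog c hδ hij) le_rfl)) hself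
  have hsum : ((ε / 3 : ℝ≥0) + (ε / 3 : ℝ≥0) + (ε / 3 : ℝ≥0) : ℝ≥0∞) = ε := by
    exact_mod_cast add_thirds ε
  rw [posEnergy_sampledMeasure]
  refine hsplit.trans ?_
  gcongr
  exact hsum ▸ add_le_add_left (add_le_add_left hn _) _

lemma eventually_posEnergy_sampledMeasure_lt (hl : ∀ k, 0 < l k) (g : ℝ →ᵇ ℝ≥0) {B : ℝ≥0∞}
    (hB : posEnergy ((P : Measure ℝ).withDensity fun x => g x)
      ((P : Measure ℝ).withDensity fun x => g x) < B) :
    ∀ᶠ n in atTop, posEnergy (sampledMeasure c l g (m n)) (sampledMeasure c l g (m n)) < B := by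
  obtain ⟨η, hη, hηB⟩ := ENNReal.lt_iff_exists_add_pos_lt.1 hB
  obtain ⟨ε, hε, hεη⟩ := ENNReal.exists_nnreal_pos_mul_lt
    (a := nndist g 0 * nndist g 0) (b := η) (by finiteness) (by exact_mod_cast hη.ne')
  obtain ⟨T, hT⟩ := h.exists_eventually_posEnergy_sampledMeasure_le hl g hε
  have hlim := (h.tendsto_lintegral_truncLog g T).add_const (nndist g 0 * nndist g 0 * ε : ℝ≥0∞)
  have hlt : ∫⁻ p, g p.1 * g p.2 * truncLog T p ∂((P : Measure ℝ).prod P)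
      + nndist g 0 * nndist g 0 * ε < B := by
    refine lt_of_le_of_lt (add_le_add ?_ ((mul_comm _ _).trans_le hεη.le)) hηB
    rw [posEnergy_withDensity g.continuous.measurable.coe_nnreal_ennreal]
    gcongr with p
    exact truncLog_le_posLog T p
  filter_upwards [hT, hlim.eventually (gt_mem_nhds hlt)] with n hn hn' using hn.trans_lt hn'

end IsSampling

lemma exists_lt_one_lt_mul_sq {E B : ℝ≥0∞} (hB : B ≠ ∞) (h : E < B) : ∃ r < 1, E < B * r ^ 2 := by
  have hcont : Continuous fun r : ℝ≥0∞ => B * r ^ 2 :=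
    (ENNReal.continuous_const_mul hB).comp (ENNReal.continuous_pow 2)
  have hnhds : ∀ᶠ r in 𝓝 (1 : ℝ≥0∞), E < B * r ^ 2 :=
    (hcont.tendsto' 1 B (by simp)).eventually (lt_mem_nhds h)
  have : (𝓝[<] (1 : ℝ≥0∞)).NeBot := nhdsLT_neBot_of_exists_lt ⟨0, zero_lt_one⟩
  have hlt : ∀ᶠ r in 𝓝[<] (1 : ℝ≥0∞), r < 1 := self_mem_nhdsWithin
  exact (hlt.and (hnhds.filter_mono nhdsWithin_le_nhds)).exists

lemma posEnergy_inv_smul_univ_lt {X : Type*} [PseudoEMetricSpace X] [MeasurableSpace X]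
    {ν : Measure X} {B r : ℝ≥0∞} (hr : r < ν univ) (h : posEnergy ν ν < B * r ^ 2) :
    posEnergy ((ν univ)⁻¹ • ν) ((ν univ)⁻¹ • ν) < B := by
  have hpos : ν univ ≠ 0 := hr.ne_bot
  have hlt : posEnergy ν ν < B * (ν univ * ν univ) :=
    h.trans_le (by rw [← sq]; gcongr)
  rw [posEnergy_smul (ENNReal.inv_ne_top.2 hpos),
    ← ENNReal.mul_inv (Or.inl hpos) (Or.inr hpos), mul_comm, ← div_eq_mul_inv]
  exact ENNReal.div_lt_of_lt_mul hlt

lemma closure_biUnion_Ioo_half_subset {c l : ℕ → ℝ} (hl : ∀ k, 0 < l k) {K U : Set ℝ} {ρ : ℝ}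
    (hρ : Metric.cthickening ρ K ⊆ U) {s : Finset ℕ} {k : ℕ}
    (hs : ∀ i ∈ s, c i ∈ K ∧ k ≤ i ∧ l i ≤ ρ) :
    closure (⋃ i ∈ s, Ioo (c i - l i / 2 / 2) (c i + l i / 2 / 2))
      ⊆ U ∩ ⋃ i ≥ k, Ioo (c i - l i / 2) (c i + l i / 2) := by
  rw [Finset.closure_biUnion]
  refine iUnion₂_subset fun i hi x hx => ?_
  rw [closure_Ioo (by linarith [hl i])] at hx
  obtain ⟨hcK, hki, hlρ⟩ := hs i hi
  refine ⟨hρ (Metric.mem_cthickening_of_dist_le x (c i) ρ K hcK ?_),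
    mem_iUnion₂.2 ⟨i, hki, by linarith [hx.1, hl i], by linarith [hx.2, hl i]⟩⟩
  exact abs_le.2 ⟨by linarith [hx.1, hl i], by linarith [hx.2, hl i]⟩

lemma IsSampling.eventually_exists_isOpen_sampledMeasure_compl {c l : ℕ → ℝ}
    {P : ProbabilityMeasure ℝ} {m : ℕ → ProbabilityMeasure ℕ} {A : ℕ → Finset ℕ}
    (h : IsSampling c l P m A) (hl : ∀ k, 0 < l k) (hl₀ : Tendsto l atTop (𝓝 0)) {U K : Set ℝ}
    (hU : IsOpen U) (hK : IsCompact K) (hKU : K ⊆ U) {g : ℝ → ℝ≥0} (hg : ∀ x ∉ K, g x = 0)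
    (k : ℕ) :
    ∀ᶠ n in atTop, ∃ U' : Set ℝ, IsOpen U' ∧
      closure U' ⊆ U ∩ ⋃ i ≥ k, Ioo (c i - l i / 2) (c i + l i / 2) ∧
      sampledMeasure c l g (m n) U'ᶜ = 0 := by
  obtain ⟨ρ, hρ, hρU⟩ := hK.exists_cthickening_subset_open hU hKU
  obtain ⟨k₀, hk₀⟩ := (hl₀.eventually (ge_mem_nhds hρ)).exists_forall_of_atTop
  filter_upwards [h.eventually_le (max k k₀)] with n hn
  set s : Finset ℕ := {i ∈ A n | g (c i) ≠ 0}
  have hopen : IsOpen (⋃ i ∈ s, Ioo (c i - l i / 2 / 2) (c i + l i / 2 / 2)) :=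
    isOpen_biUnion fun _ _ => isOpen_Ioo
  refine ⟨_, hopen, closure_biUnion_Ioo_half_subset hl hρU fun i hi => ?_,
    sampledMeasure_compl_eq_zero hopen.measurableSet <| (h.ae_mem n).mono fun i hi hgi =>
      subset_biUnion_of_mem (u := fun i => Ioo (c i - l i / 2 / 2) (c i + l i / 2 / 2))
        (Finset.mem_coe.2 (Finset.mem_filter.2 ⟨hi, hgi⟩))⟩
  obtain ⟨hiA, hgi⟩ := Finset.mem_filter.1 hi
  have hki := max_le_iff.1 (hn i hiA)
  exact ⟨not_imp_comm.1 (hg _) hgi, hki.1, hk₀ i hki.2⟩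

lemma isFiniteMeasure_sampledMeasure {c l : ℕ → ℝ} (hl : ∀ k, 0 < l k) (g : ℝ →ᵇ ℝ≥0)
    (m : Measure ℕ) [IsFiniteMeasure m] : IsFiniteMeasure (sampledMeasure c l g m) := by
  refine ⟨(sampledMeasure_univ hl).trans_lt ?_⟩
  exact (g.compContinuous ⟨c, continuous_of_discreteTopology⟩).lintegral_lt_top_of_nnreal m

lemma absolutelyContinuous_of_restrict {X : Type*} [MeasurableSpace X] {μ ν P : Measure X}
    {S : Set X} (hP : μ.restrict S ≪ P) (h : ν ≪ μ) (hS : ν Sᶜ = 0) : ν ≪ P := by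
  have hrestrict := (h.restrict S).trans hP
  rwa [Measure.restrict_eq_self_of_ae_mem hS] at hrestrict

/-- The open set `U ⊆ [0, 1]` carries the probability measure `ν`, which is absolutely continuous
with respect to the sampled measure `P` and has energy less than `B`. -/
structure IsApproximant (P : Measure ℝ) (B : ℝ≥0∞) (U : Set ℝ) (ν : Measure ℝ) : Prop where
  isOpen : IsOpen U
  subset_Icc : U ⊆ Icc 0 1
  isProbabilityMeasure : IsProbabilityMeasure ν
  absolutelyContinuous : ν ≪ P
  measure_compl : ν Uᶜ = 0
  posEnergy_lt : posEnergy ν ν < B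

section Iteration

variable {c l : ℕ → ℝ} {P : ProbabilityMeasure ℝ} {m : ℕ → ProbabilityMeasure ℕ} {A : ℕ → Finset ℕ}
  (h : IsSampling c l P m A) (hl : ∀ k, 0 < l k) (hl₀ : Tendsto l atTop (𝓝 0))
  (hP : volume.restrict (Icc (0 : ℝ) 1) ≪ P) {B : ℝ≥0∞} (hB : B ≠ ∞)

include h hl hl₀ hP hB

lemma IsApproximant.exists_next {U : Set ℝ} {ν : Measure ℝ} (hU : IsApproximant P B U ν) (k : ℕ) :
    ∃ U' ν', IsApproximant P B U' ν' ∧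
      closure U' ⊆ U ∩ ⋃ i ≥ k, Ioo (c i - l i / 2) (c i + l i / 2) := by
  have := hU.isProbabilityMeasure
  obtain ⟨r, hr, hνr⟩ := exists_lt_one_lt_mul_sq hB hU.posEnergy_lt
  obtain ⟨g, K, hK, hKU, hgK, hgr, hgE⟩ := exists_boundedContinuous_posEnergy_withDensity_lt
    h.posEnergy_ne_top hU.absolutelyContinuous hU.isOpen hU.measure_compl hr hνr
  obtain ⟨n, hE, hmass, U', hU', hclosure, hcompl⟩ :=
    ((h.eventually_posEnergy_sampledMeasure_lt hl g hgE).and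
      (((h.tendsto_lintegral g).eventually (lt_mem_nhds hgr)).and
        (h.eventually_exists_isOpen_sampledMeasure_compl hl hl₀ hU.isOpen hK hKU hgK k))).exists
  set ν' := sampledMeasure c l g (m n)
  have hsub : U' ⊆ Icc 0 1 :=
    subset_closure.trans (hclosure.trans (inter_subset_left.trans hU.subset_Icc))
  have hr' : r < ν' univ := hmass.trans_eq (sampledMeasure_univ hl).symm
  have hfinite : IsFiniteMeasure ν' := isFiniteMeasure_sampledMeasure hl g (m n)
  have : NeZero ν' := ⟨fun hzero => by simp [hzero] at hr'⟩
  refine ⟨U', (ν' univ)⁻¹ • ν', ⟨hU', hsub, inferInstance, ?_, ?_,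
    posEnergy_inv_smul_univ_lt hr' hE⟩, hclosure⟩
  · exact (absolutelyContinuous_of_restrict hP sampledMeasure_absolutelyContinuous
      (measure_mono_null (compl_subset_compl.2 hsub) hcompl)).smul_left _
  · rw [Measure.smul_apply, hcompl, smul_zero]

lemma exists_isCompact_posEnergy_le_of_sampling {ν : Measure ℝ} [IsProbabilityMeasure ν]
    (hν : ν (Icc 0 1)ᶜ = 0) (hνB : posEnergy ν ν < B) :
    ∃ K ⊆ limsupIntervals c l, IsCompact K ∧
      ∃ μ : Measure ℝ, IsProbabilityMeasure μ ∧ μ Kᶜ = 0 ∧ posEnergy μ μ ≤ B := by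
  obtain ⟨ν₀, hν₀, hac, hcompl, hlt⟩ := exists_absolutelyContinuous_posEnergy_lt ν hν hνB
  have hac₀ : ν₀ ≪ P := absolutelyContinuous_of_restrict hP hac
    (measure_mono_null (compl_subset_compl.2 Ioo_subset_Icc_self) hcompl)
  have hstep : ∀ (k : ℕ) (p : {p : Set ℝ × Measure ℝ // IsApproximant P B p.1 p.2}),
      ∃ p' : {p : Set ℝ × Measure ℝ // IsApproximant P B p.1 p.2},
        closure p'.1.1 ⊆ p.1.1 ∩ ⋃ i ≥ k, Ioo (c i - l i / 2) (c i + l i / 2) := fun k p => by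
    obtain ⟨U', ν', hU', hsub⟩ := p.2.exists_next h hl hl₀ hP hB k
    exact ⟨⟨(U', ν'), hU'⟩, hsub⟩
  choose next hnext using hstep
  let seq : ℕ → {p : Set ℝ × Measure ℝ // IsApproximant P B p.1 p.2} :=
    Nat.rec ⟨(Ioo 0 1, ν₀), isOpen_Ioo, Ioo_subset_Icc_self, hν₀, hac₀, hcompl, hlt⟩ next
  have hseq : ∀ k, closure (seq (k + 1)).1.1
      ⊆ (seq k).1.1 ∩ ⋃ i ≥ k, Ioo (c i - l i / 2) (c i + l i / 2) := fun k => hnext k (seq k)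
  have hcompact : IsCompact (closure (seq 0).1.1) :=
    isCompact_Icc.of_isClosed_subset isClosed_closure
      (closure_minimal (seq 0).2.subset_Icc isClosed_Icc)
  refine ⟨⋂ j, closure (seq j).1.1, subset_iInter fun k =>
      (iInter_subset _ (k + 1)).trans ((hseq k).trans inter_subset_right),
    hcompact.of_isClosed_subset (isClosed_iInter fun j => isClosed_closure) (iInter_subset _ 0), ?_⟩
  exact exists_measure_iInter_of_nested hcompact (fun k => (hseq k).trans inter_subset_left)
    (fun j => (seq j).2.isProbabilityMeasure) (fun j => (seq j).2.measure_compl)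
    fun j => (seq j).2.posEnergy_lt.le

end Iteration

theorem realCapacity_limsupIntervals_eq_of_sampling {c l : ℕ → ℝ} {P : ProbabilityMeasure ℝ}
    {m : ℕ → ProbabilityMeasure ℕ} {A : ℕ → Finset ℕ} (h : IsSampling c l P m A)
    (hl : ∀ k, 0 < l k) (hl₀ : Tendsto l atTop (𝓝 0))
    (hP : volume.restrict (Icc (0 : ℝ) 1) ≪ P) (hsub : limsupIntervals c l ⊆ Icc 0 1) :
    realCapacity (limsupIntervals c l) = realCapacity (Icc 0 1) := by
  refine le_antisymm (realCapacity_mono hsub)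
    (realCapacity_le_of_posEnergy subset_rfl hsub fun ν _ hν B hνB => ?_)
  obtain ⟨B', hνB', hB'⟩ := exists_between hνB
  obtain ⟨K, hK, hKcompact, μ, hμ, hμK, hμB'⟩ :=
    exists_isCompact_posEnergy_le_of_sampling h hl hl₀ hP hB'.ne_top hν hνB'
  exact ⟨K, hK, hKcompact, μ, hμ, hμK, hμB'.trans hB'.le⟩

/-! ### The blocks of indices -/

section BlockLaws

lemma card_block (n : ℕ) : (block n).card = n := by
  rw [block, Nat.card_Ico]
  omega

lemma disjoint_block_two_pow {n s t : ℕ} (h : s ≠ t) :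
    Disjoint (block (2 ^ s * n)) (block (2 ^ t * n)) := by
  wlog hst : s < t generalizing s t
  · exact (this h.symm (h.lt_or_gt.resolve_left hst)).symm
  have hle : 2 * (2 ^ s * n) ≤ 2 ^ t * n := by
    rw [← mul_assoc, ← pow_succ']
    exact Nat.mul_le_mul_right n (Nat.pow_le_pow_right two_pos hst)
  exact Finset.disjoint_left.2 fun i hi hj =>
    ((Finset.mem_Ico.1 hi).2.trans_le (hle.trans (Finset.mem_Ico.1 hj).1)).false

lemma le_of_mem_multiBlock {n q i : ℕ} (hi : i ∈ multiBlock n q) : n ≤ i := by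
  obtain ⟨s, -, hs⟩ := Finset.mem_biUnion.1 hi
  exact (Nat.le_mul_of_pos_left n (Nat.two_pow_pos s)).trans (Finset.mem_Ico.1 hs).1

lemma lintegral_uniformOn {α : Type*} [MeasurableSpace α] [MeasurableSingletonClass α]
    (s : Finset α) (f : α → ℝ≥0∞) :
    ∫⁻ x, f x ∂uniformOn s = (s.card : ℝ≥0∞)⁻¹ * ∑ x ∈ s, f x := by
  simp only [uniformOn, ProbabilityTheory.cond, lintegral_smul_measure, lintegral_finset,
    Measure.count_singleton, mul_one, Measure.count_apply_finset, smul_eq_mul]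

/-- The uniform probability measure on the block `A_n` (the zero measure for `n = 0`). -/
def blockLaw (n : ℕ) : Measure ℕ := uniformOn (block n)

instance isProbabilityMeasure_blockLaw (n : ℕ) [NeZero n] : IsProbabilityMeasure (blockLaw n) :=
  isProbabilityMeasure_uniformOn (block n).finite_toSet
    (Finset.card_pos.1 ((card_block n).symm ▸ Nat.pos_of_neZero n))

lemma lintegral_blockLaw (n : ℕ) (f : ℕ → ℝ≥0∞) :
    ∫⁻ i, f i ∂blockLaw n = (n : ℝ≥0∞)⁻¹ * ∑ i ∈ block n, f i := by
  rw [blockLaw, lintegral_uniformOn, card_block]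

lemma lintegral_blockLaw_prod (n n' : ℕ) (f : ℕ × ℕ → ℝ≥0∞) :
    ∫⁻ p, f p ∂(blockLaw n).prod (blockLaw n')
      = ((block n ×ˢ block n').card : ℝ≥0∞)⁻¹ * ∑ p ∈ block n ×ˢ block n', f p := by
  rw [lintegral_prod _ (measurable_of_countable f).aemeasurable]
  simp only [lintegral_blockLaw]
  rw [← Finset.mul_sum, Finset.sum_product, ← mul_assoc, Finset.card_product, card_block,
    card_block, Nat.cast_mul, ENNReal.mul_inv (Or.inr (ENNReal.natCast_ne_top _))
      (Or.inl (ENNReal.natCast_ne_top _))]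

lemma blockLaw_singleton_of_notMem {n i : ℕ} (hi : i ∉ block n) : blockLaw n {i} = 0 := by
  rw [blockLaw, uniformOn_eq_zero_iff (block n).finite_toSet, inter_singleton_eq_empty]
  exact_mod_cast hi

lemma blockLaw_singleton_mul_le (n i : ℕ) : blockLaw n {i} * i ≤ 2 := by
  by_cases hi : i ∈ block n
  · have hin : (i : ℝ≥0∞) ≤ 2 * n := by exact_mod_cast (Finset.mem_Ico.1 hi).2.le
    have hval : blockLaw n {i} = (n : ℝ≥0∞)⁻¹ := by
      rw [blockLaw, ← Finset.coe_singleton, uniformOn_apply_finset,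
        Finset.inter_singleton_of_mem hi, card_block, Finset.card_singleton, Nat.cast_one, one_div]
    rw [hval, mul_comm, ← div_eq_mul_inv]
    exact ENNReal.div_le_of_le_mul hin
  · rw [blockLaw_singleton_of_notMem hi, zero_mul]
    exact zero_le

/-- The mixture, with equal weights, of the uniform measures on the blocks that make up
`A_{n,q}`. -/
def multiBlockLaw (n q : ℕ) : Measure ℕ :=
  ((q + 1 : ℕ) : ℝ≥0∞)⁻¹ • ∑ s ∈ Finset.range (q + 1), blockLaw (2 ^ s * n)

lemma ae_mem_multiBlock (n q : ℕ) : ∀ᵐ i ∂multiBlockLaw n q, i ∈ multiBlock n q := by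
  refine Measure.ae_smul_measure (ae_finsetSum_measure_iff.2 fun s hs => ?_) _
  filter_upwards [ae_cond_mem (μ := Measure.count) (block (2 ^ s * n)).measurableSet] with i hi
  exact Finset.mem_biUnion.2 ⟨s, hs, hi⟩

lemma lintegral_multiBlockLaw (n q : ℕ) (f : ℕ → ℝ≥0∞) :
    ∫⁻ i, f i ∂multiBlockLaw n q = ((q + 1 : ℕ) : ℝ≥0∞)⁻¹ *
      ∑ s ∈ Finset.range (q + 1), ∫⁻ i, f i ∂blockLaw (2 ^ s * n) := by
  rw [multiBlockLaw, lintegral_smul_measure, lintegral_finsetSum_measure, smul_eq_mul]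

variable {n q : ℕ} {f : ℕ → ℝ≥0∞} {C : ℝ≥0∞}

lemma inv_mul_sum_range_const (q : ℕ) (C : ℝ≥0∞) :
    ((q + 1 : ℕ) : ℝ≥0∞)⁻¹ * ∑ _s ∈ Finset.range (q + 1), C = C := by
  rw [Finset.sum_const, Finset.card_range, nsmul_eq_mul,
    ENNReal.inv_mul_cancel_left (Nat.cast_ne_zero.2 q.succ_ne_zero) (ENNReal.natCast_ne_top _)]

lemma lintegral_multiBlockLaw_le (h : ∀ s ≤ q, ∫⁻ i, f i ∂blockLaw (2 ^ s * n) ≤ C) :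
    ∫⁻ i, f i ∂multiBlockLaw n q ≤ C := by
  rw [lintegral_multiBlockLaw, ← inv_mul_sum_range_const q C]
  gcongr with s hs
  exact h s (Finset.mem_range_succ_iff.1 hs)

lemma le_lintegral_multiBlockLaw (h : ∀ s ≤ q, C ≤ ∫⁻ i, f i ∂blockLaw (2 ^ s * n)) :
    C ≤ ∫⁻ i, f i ∂multiBlockLaw n q := by
  rw [lintegral_multiBlockLaw, ← inv_mul_sum_range_const q C]
  gcongr with s hs
  exact h s (Finset.mem_range_succ_iff.1 hs)

instance isProbabilityMeasure_multiBlockLaw [NeZero n] :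
    IsProbabilityMeasure (multiBlockLaw n q) := by
  refine ⟨?_⟩
  rw [← lintegral_one]
  exact le_antisymm (lintegral_multiBlockLaw_le fun s _ => by simp)
    (le_lintegral_multiBlockLaw fun s _ => by simp)

lemma lintegral_multiBlockLaw_prod_le [NeZero n] {f : ℕ × ℕ → ℝ≥0∞}
    (h : ∀ s ≤ q, ∀ t ≤ q,
      ∫⁻ p, f p ∂(blockLaw (2 ^ s * n)).prod (blockLaw (2 ^ t * n)) ≤ C) :
    ∫⁻ p, f p ∂(multiBlockLaw n q).prod (multiBlockLaw n q) ≤ C := by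
  rw [lintegral_prod _ (measurable_of_countable f).aemeasurable]
  refine lintegral_multiBlockLaw_le fun s hs => ?_
  rw [← lintegral_prod _ (measurable_of_countable f).aemeasurable,
    lintegral_prod_symm _ (measurable_of_countable f).aemeasurable]
  refine lintegral_multiBlockLaw_le fun t ht => ?_
  rw [← lintegral_prod_symm _ (measurable_of_countable f).aemeasurable]
  exact h s hs t ht

lemma multiBlockLaw_singleton_mul_le (n q i : ℕ) :
    multiBlockLaw n q {i} * i ≤ 2 * ((q + 1 : ℕ) : ℝ≥0∞)⁻¹ := by
  have hsum : (∑ s ∈ Finset.range (q + 1), blockLaw (2 ^ s * n) {i}) * i ≤ 2 := by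
    by_cases hi : ∃ s ∈ Finset.range (q + 1), i ∈ block (2 ^ s * n)
    · obtain ⟨s, hs, his⟩ := hi
      rw [Finset.sum_eq_single_of_mem s hs fun t _ hts => blockLaw_singleton_of_notMem
        (Finset.disjoint_left.1 (disjoint_block_two_pow hts.symm) his)]
      exact blockLaw_singleton_mul_le _ i
    · rw [Finset.sum_eq_zero fun s hs => blockLaw_singleton_of_notMem fun his => hi ⟨s, hs, his⟩]
      simp only [zero_mul, zero_le]
  rw [multiBlockLaw, Measure.smul_apply, Measure.finsetSum_apply, smul_eq_mul, mul_assoc, mul_comm]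
  gcongr

lemma tendsto_lintegral_multiBlockLaw {L : ℝ≥0∞} (hL : L ≠ ∞)
    (h : Tendsto (fun n => ∫⁻ i, f i ∂blockLaw n) atTop (𝓝 L)) (q : ℕ → ℕ) :
    Tendsto (fun n => ∫⁻ i, f i ∂multiBlockLaw n (q n)) atTop (𝓝 L) := by
  rw [ENNReal.tendsto_nhds hL] at h ⊢
  intro ε hε
  obtain ⟨n₀, hn₀⟩ := (h ε hε).exists_forall_of_atTop
  filter_upwards [eventually_ge_atTop n₀] with n hn
  have hmem : ∀ s, ∫⁻ i, f i ∂blockLaw (2 ^ s * n) ∈ Icc (L - ε) (L + ε) := fun s =>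
    hn₀ _ (hn.trans (Nat.le_mul_of_pos_left n (Nat.two_pow_pos s)))
  exact ⟨le_lintegral_multiBlockLaw fun s _ => (hmem s).1,
    lintegral_multiBlockLaw_le fun s _ => (hmem s).2⟩

end BlockLaws

section Centers

variable {c l : ℕ → ℝ} {q : ℕ → ℕ}

lemma isProbabilityMeasure_withDensity_of_tendsto_average {φ : ℝ → ℝ}
    (hφ : IntegrableOn φ (Icc 0 1)) (hpos : ∀ᵐ x ∂volume.restrict (Icc (0 : ℝ) 1), 0 < φ x)
    (hlim : Tendsto (fun n => (∑ _k ∈ block n, (1 : ℝ)) / (block n).card) atTop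
      (𝓝 (∫ x in Icc (0 : ℝ) 1, φ x))) :
    IsProbabilityMeasure
      ((volume.restrict (Icc (0 : ℝ) 1)).withDensity fun x => ENNReal.ofReal (φ x)) := by
  have hint : ∫ x in Icc (0 : ℝ) 1, φ x = 1 := by
    refine tendsto_nhds_unique hlim (tendsto_const_nhds.congr' ?_)
    filter_upwards [eventually_ne_atTop 0] with n hn
    rw [Finset.sum_const, nsmul_one, card_block, div_self (Nat.cast_ne_zero.2 hn)]
  refine ⟨?_⟩
  rw [withDensity_apply _ MeasurableSet.univ, Measure.restrict_univ,
    ← ofReal_integral_eq_lintegral_ofReal hφ (hpos.mono fun x hx => hx.le), hint,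
    ENNReal.ofReal_one]

lemma ofReal_average_eq_lintegral_blockLaw (g : ℝ → ℝ≥0) {n : ℕ} (hn : n ≠ 0) :
    ENNReal.ofReal ((∑ k ∈ block n, (g (c k) : ℝ)) / (block n).card)
      = ∫⁻ i, g (c i) ∂blockLaw n := by
  rw [lintegral_blockLaw, card_block, ENNReal.ofReal_div_of_pos (by positivity),
    ENNReal.div_eq_inv_mul, ENNReal.ofReal_natCast,
    ENNReal.ofReal_sum_of_nonneg fun _ _ => NNReal.coe_nonneg _]
  simp only [ENNReal.ofReal_coe_nnreal]

lemma CentersDistributed.exists_tendsto_lintegral_blockLaw (h : CentersDistributed c) :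
    ∃ P : ProbabilityMeasure ℝ, volume.restrict (Icc (0 : ℝ) 1) ≪ P ∧ ∀ g : ℝ →ᵇ ℝ≥0,
      Tendsto (fun n => ∫⁻ i, g (c i) ∂blockLaw n) atTop (𝓝 (∫⁻ x, g x ∂(P : Measure ℝ))) := by
  obtain ⟨φ, hφ, hpos, hlim⟩ := h
  have hae : AEMeasurable (fun x => ENNReal.ofReal (φ x)) (volume.restrict (Icc (0 : ℝ) 1)) :=
    hφ.aestronglyMeasurable.aemeasurable.ennreal_ofReal
  have hprob := isProbabilityMeasure_withDensity_of_tendsto_average hφ hpos <| by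
    simpa only [one_mul] using hlim (fun _ => 1) continuousOn_const
  refine ⟨⟨_, hprob⟩, withDensity_absolutelyContinuous' hae
    (hpos.mono fun x hx => (ENNReal.ofReal_pos.2 hx).ne'), fun g => ?_⟩
  have hgφ : Integrable (fun x => (g x : ℝ) * φ x) (volume.restrict (Icc 0 1)) :=
    hφ.continuousOn_mul (NNReal.continuous_coe.comp g.continuous).continuousOn isCompact_Icc
  have hlintegral : ENNReal.ofReal (∫ x in Icc (0 : ℝ) 1, g x * φ x) = ∫⁻ x, g x
      ∂(volume.restrict (Icc (0 : ℝ) 1)).withDensity fun x => ENNReal.ofReal (φ x) := by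
    rw [ofReal_integral_eq_lintegral_ofReal hgφ
      (hpos.mono fun x hx => mul_nonneg (NNReal.coe_nonneg _) hx.le),
      lintegral_withDensity_eq_lintegral_mul₀ hae
        g.continuous.measurable.coe_nnreal_ennreal.aemeasurable]
    refine lintegral_congr fun x => ?_
    rw [ENNReal.ofReal_mul (NNReal.coe_nonneg _), ENNReal.ofReal_coe_nnreal, Pi.mul_apply, mul_comm]
  have hreal := (ENNReal.continuous_ofReal.tendsto _).comp
    (hlim (fun x => g x) (NNReal.continuous_coe.comp g.continuous).continuousOn)
  rw [hlintegral] at hreal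
  refine hreal.congr' ?_
  filter_upwards [eventually_ne_atTop 0] with n hn using ofReal_average_eq_lintegral_blockLaw g hn

lemma lintegral_nearLog_blockLaw_prod_le (hc : ∀ k, c k ∈ Icc (0 : ℝ) 1) {N N' : ℕ} [NeZero N]
    [NeZero N'] (hne : ∀ i ∈ block N, ∀ j ∈ block N', i ≠ j → c i ≠ c j) {δ ε : ℝ}
    (h : (∑ p ∈ block N ×ˢ block N' with p.1 ≠ p.2 ∧ |c p.1 - c p.2| < δ,
        -Real.log |c p.1 - c p.2|) / ((block N ×ˢ block N').card : ℝ) < ε) :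
    ∫⁻ p, nearLog c δ p ∂(blockLaw N).prod (blockLaw N') ≤ ENNReal.ofReal ε := by
  have hcard : (0 : ℝ) < (block N ×ˢ block N').card := by
    rw [Finset.card_product, card_block, card_block]
    exact_mod_cast Nat.mul_pos (Nat.pos_of_neZero N) (Nat.pos_of_neZero N')
  have hsum : ∑ p ∈ block N ×ˢ block N', nearLog c δ p
      = ENNReal.ofReal (∑ p ∈ block N ×ˢ block N' with p.1 ≠ p.2 ∧ |c p.1 - c p.2| < δ,
        -Real.log |c p.1 - c p.2|) := by
    rw [ENNReal.ofReal_sum_of_nonneg fun p _ => neg_nonneg.2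
      (Real.log_nonpos (abs_nonneg _)
        (abs_sub_le_of_nonneg_of_le (hc p.1).1 (hc p.1).2 (hc p.2).1 (hc p.2).2)),
      Finset.sum_filter]
    refine Finset.sum_congr rfl fun p hp => ?_
    obtain ⟨hp₁, hp₂⟩ := Finset.mem_product.1 hp
    simp only [nearLog]
    split_ifs with hnear
    · exact posLog_of_ne (hne _ hp₁ _ hp₂ hnear.1)
    · rfl
  rw [lintegral_blockLaw_prod, hsum, ← ENNReal.div_eq_inv_mul, ← ENNReal.ofReal_natCast,
    ← ENNReal.ofReal_div_of_pos hcard]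
  exact ENNReal.ofReal_le_ofReal h.le

lemma LogAverageSpacing.exists_eventually_lintegral_nearLog_le (hc : ∀ k, c k ∈ Icc (0 : ℝ) 1)
    (hspacing : LogAverageSpacing c q) (hgap : GapControl c l q) {ε : ℝ≥0} (hε : 0 < ε) :
    ∃ δ > 0, ∀ᶠ n in atTop, ∫⁻ p, nearLog c δ p
      ∂(multiBlockLaw n (q n)).prod (multiBlockLaw n (q n)) ≤ ε := by
  obtain ⟨δ, hδ, hnear⟩ := hspacing ε hε
  refine ⟨δ, hδ, ?_⟩
  filter_upwards [hnear, hgap 1 one_pos, eventually_ne_atTop 0] with n hn hdist hn₀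
  have : NeZero n := ⟨hn₀⟩
  refine lintegral_multiBlockLaw_prod_le fun s hs t ht => ?_
  have hmem : ∀ {s}, s ≤ q n → ∀ i ∈ block (2 ^ s * n), i ∈ multiBlock n (q n) := fun hs i hi =>
    Finset.mem_biUnion.2 ⟨_, Finset.mem_range_succ_iff.2 hs, hi⟩
  exact (lintegral_nearLog_blockLaw_prod_le hc (fun i hi j hj hij =>
    (hdist i (hmem hs i hi) j (hmem ht j hj) hij).1) (hn s hs t ht)).trans_eq
      ENNReal.ofReal_coe_nnreal

lemma GapControl.eventually_separated (hgap : GapControl c l q) {ε : ℝ} (hε : 0 < ε) :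
    ∀ᶠ n in atTop, ∀ i ∈ multiBlock n (q n), ∀ j ∈ multiBlock n (q n), i ≠ j →
      c i ≠ c j ∧ (l i + l j) / 2 ≤ ε * |c i - c j| := by
  filter_upwards [hgap ε hε] with n hn i hi j hj hij
  obtain ⟨hne, hlt⟩ := hn i hi j hj hij
  refine ⟨hne, ?_⟩
  rw [← div_div, div_lt_iff₀ (abs_pos.2 (sub_ne_zero.2 hne))] at hlt
  exact hlt.le

lemma eventually_multiBlockLaw_singleton_mul_log_le (hq : Tendsto q atTop atTop)
    (hlog : (fun k => Real.log (l k)) =O[atTop] fun k => (k : ℝ)) {ε : ℝ≥0} (hε : 0 < ε) :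
    ∀ᶠ n in atTop, ∀ i ∈ multiBlock n (q n),
      multiBlockLaw n (q n) {i} * (1 + ENNReal.ofReal (-Real.log (l i))) ≤ ε := by
  obtain ⟨C, hlogC⟩ := hlog.bound
  obtain ⟨k₀, hk₀⟩ := (hlogC.and (eventually_ge_atTop 1)).exists_forall_of_atTop
  have hlim : Tendsto (fun n => 2 * ((q n + 1 : ℕ) : ℝ≥0∞)⁻¹ * (1 + ENNReal.ofReal C)) atTop
      (𝓝 0) := by
    have hinv : Tendsto (fun n => ((q n + 1 : ℕ) : ℝ≥0∞)⁻¹) atTop (𝓝 0) :=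
      ENNReal.tendsto_inv_nat_nhds_zero.comp ((tendsto_add_atTop_nat 1).comp hq)
    simpa only [mul_zero, zero_mul] using ENNReal.Tendsto.mul_const
      (ENNReal.Tendsto.const_mul hinv (Or.inr ENNReal.ofNat_ne_top)) (Or.inr (by finiteness))
  filter_upwards [hlim.eventually (ge_mem_nhds (ENNReal.coe_pos.2 hε)), eventually_ge_atTop k₀]
    with n hn hkn i hi
  obtain ⟨hi, hi₁⟩ := hk₀ i (hkn.trans (le_of_mem_multiBlock hi))
  have hfactor : 1 + ENNReal.ofReal (-Real.log (l i)) ≤ i * (1 + ENNReal.ofReal C) := by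
    rw [mul_add, mul_one, ← ENNReal.ofReal_natCast, ← ENNReal.ofReal_mul i.cast_nonneg,
      ENNReal.ofReal_natCast]
    refine add_le_add (by exact_mod_cast hi₁) (ENNReal.ofReal_le_ofReal ?_)
    rw [mul_comm]
    simpa using (neg_le_abs _).trans hi
  calc multiBlockLaw n (q n) {i} * (1 + ENNReal.ofReal (-Real.log (l i)))
      ≤ multiBlockLaw n (q n) {i} * i * (1 + ENNReal.ofReal C) := by
        rw [mul_assoc]
        gcongr
    _ ≤ 2 * ((q n + 1 : ℕ) : ℝ≥0∞)⁻¹ * (1 + ENNReal.ofReal C) := by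
        gcongr ?_ * _
        exact multiBlockLaw_singleton_mul_le n (q n) i
    _ ≤ ε := hn

lemma isSampling_multiBlockLaw (hc : ∀ k, c k ∈ Icc (0 : ℝ) 1)
    (hlog : (fun k => Real.log (l k)) =O[atTop] fun k => (k : ℝ)) {P : ProbabilityMeasure ℝ}
    (hP : ∀ g : ℝ →ᵇ ℝ≥0,
      Tendsto (fun n => ∫⁻ i, g (c i) ∂blockLaw n) atTop (𝓝 (∫⁻ x, g x ∂(P : Measure ℝ))))
    (hq : Tendsto q atTop atTop) (hspacing : LogAverageSpacing c q) (hgap : GapControl c l q) :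
    IsSampling c l P (fun n => ⟨multiBlockLaw (n + 1) (q (n + 1)), inferInstance⟩)
      fun n => multiBlock (n + 1) (q (n + 1)) where
  tendsto_map := by
    refine ProbabilityMeasure.tendsto_iff_forall_lintegral_tendsto.2 fun g => ?_
    have hlim := (tendsto_lintegral_multiBlockLaw (g.lintegral_lt_top_of_nnreal P).ne
      (hP g) q).comp (tendsto_add_atTop_nat 1)
    exact hlim.congr fun n => (lintegral_map g.continuous.measurable.coe_nnreal_ennreal
      (measurable_of_countable c)).symm
  ae_mem n := ae_mem_multiBlock _ _
  eventually_le k := by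
    filter_upwards [eventually_ge_atTop k] with n hn i hi
    exact hn.trans (n.le_succ.trans (le_of_mem_multiBlock hi))
  near ε hε := by
    obtain ⟨δ, hδ, h⟩ := hspacing.exists_eventually_lintegral_nearLog_le hc hgap hε
    exact ⟨δ, hδ, (tendsto_add_atTop_nat 1).eventually h⟩
  separated ε hε := (tendsto_add_atTop_nat 1).eventually (hgap.eventually_separated hε)
  self ε hε := (tendsto_add_atTop_nat 1).eventually
    (eventually_multiBlockLaw_singleton_mul_log_le hq hlog hε)

lemma limsupIntervals_subset_Icc (hc : ∀ k, c k ∈ Icc (0 : ℝ) 1) (hl₀ : Tendsto l atTop (𝓝 0)) :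
    limsupIntervals c l ⊆ Icc 0 1 := by
  intro x hx
  simp only [limsupIntervals, mem_iInter, mem_iUnion, exists_prop] at hx
  have happrox : ∀ ε > 0, -ε ≤ x ∧ x ≤ 1 + ε := by
    intro ε hε
    obtain ⟨m, hm⟩ := (hl₀.eventually (gt_mem_nhds hε)).exists_forall_of_atTop
    obtain ⟨k, hk, hleft, hright⟩ := hx m
    have hlk := hm k hk
    obtain ⟨hc₀, hc₁⟩ := hc k
    constructor <;> linarith
  exact ⟨le_of_forall_pos_le_add fun ε hε => by linarith [happrox ε hε],
    le_of_forall_pos_le_add fun ε hε => (happrox ε hε).2⟩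

theorem realCapacity_limsupIntervals_eq (hc : ∀ k, c k ∈ Icc (0 : ℝ) 1) (hl : ∀ k, 0 < l k)
    (hl₀ : Tendsto l atTop (𝓝 0)) (hlog : (fun k => Real.log (l k)) =O[atTop] fun k => (k : ℝ))
    (hdist : CentersDistributed c) (hq : Tendsto q atTop atTop) (hspacing : LogAverageSpacing c q)
    (hgap : GapControl c l q) : realCapacity (limsupIntervals c l) = realCapacity (Icc 0 1) := by
  obtain ⟨P, hac, hP⟩ := hdist.exists_tendsto_lintegral_blockLaw
  exact realCapacity_limsupIntervals_eq_of_sampling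
    (isSampling_multiBlockLaw hc hlog hP hq hspacing hgap) hl hl₀ hac
    (limsupIntervals_subset_Icc hc hl₀)

lemma limsupIntervals_mono {l' : ℕ → ℝ} (h : ∀ᶠ k in atTop, l k ≤ l' k) :
    limsupIntervals c l ⊆ limsupIntervals c l' := by
  obtain ⟨k₀, hk₀⟩ := h.exists_forall_of_atTop
  intro x hx
  simp only [limsupIntervals, mem_iInter, mem_iUnion, exists_prop] at hx ⊢
  intro m
  obtain ⟨k, hk, hleft, hright⟩ := hx (max m k₀)
  have hle := hk₀ k ((le_max_right m k₀).trans hk)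
  exact ⟨k, (le_max_left m k₀).trans hk, by linarith, by linarith⟩

end Centers

section StretchedExponential

variable {lam α : ℝ} (hlam : 0 < lam)
include hlam

lemma tendsto_exp_neg_mul_rpow (hα : 0 < α) :
    Tendsto (fun k : ℕ => Real.exp (-lam * (k : ℝ) ^ α)) atTop (𝓝 0) :=
  Real.tendsto_exp_atBot.comp (((tendsto_rpow_atTop hα).comp
    tendsto_natCast_atTop_atTop).const_mul_atTop_of_neg (neg_neg_of_pos hlam))

lemma exp_neg_mul_le_exp_neg_mul_rpow (hα : α ≤ 1) {k : ℕ} (hk : 1 ≤ k) :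
    Real.exp (-lam * k) ≤ Real.exp (-lam * (k : ℝ) ^ α) := by
  have hpow : (k : ℝ) ^ α ≤ k := by
    simpa only [Real.rpow_one] using Real.rpow_le_rpow_of_exponent_le (Nat.one_le_cast.2 hk) hα
  exact Real.exp_le_exp.2 (mul_le_mul_of_nonpos_left hpow (neg_nonpos.2 hlam.le))

lemma realCapacity_limsupIntervals_exp_neg_mul_rpow_eq_zero (hα : 1 < α) (c : ℕ → ℝ) :
    realCapacity (limsupIntervals c fun k => Real.exp (-lam * (k : ℝ) ^ α)) = 0 := by
  refine realCapacity_limsupIntervals_eq_zero ?_ ?_ c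
  · filter_upwards [eventually_ge_atTop 1] with k hk
    have hk₀ : (0 : ℝ) < k := Nat.cast_pos.2 hk
    exact ⟨Real.exp_pos _, Real.exp_lt_one_iff.2
      (mul_neg_of_neg_of_pos (neg_neg_of_pos hlam) (by positivity))⟩
  · simp only [Real.log_exp, mul_inv]
    exact (Real.summable_nat_rpow_inv.2 hα).mul_left _

end StretchedExponential

lemma realCapacity_limsupIntervals_exp_neg_mul_eq {c : ℕ → ℝ} (hc : ∀ k, c k ∈ Icc (0 : ℝ) 1)
    {lam : ℝ} (hlam : 0 < lam) (hdist : CentersDistributed c) {q : ℕ → ℕ}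
    (hq : Tendsto q atTop atTop) (hspacing : LogAverageSpacing c q)
    (hgap : GapControl c (fun k => Real.exp (-lam * (k : ℝ))) q) :
    realCapacity (limsupIntervals c fun k => Real.exp (-lam * (k : ℝ)))
      = realCapacity (Icc 0 1) := by
  refine realCapacity_limsupIntervals_eq hc (fun k => Real.exp_pos _) ?_ ?_ hdist hq hspacing hgap
  · simpa only [Real.rpow_one] using tendsto_exp_neg_mul_rpow hlam one_pos
  · simp only [Real.log_exp]
    exact Asymptotics.isBigO_const_mul_self _ _ _

end

theorem mainTheorem4 (c : ℕ → ℝ) (hc : ∀ k, c k ∈ Set.Ioo (0 : ℝ) 1) (lam : ℝ) (hlam : 0 < lam)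
    (hA1 : CentersDistributed c)
    (hA23 : ∃ q : ℕ → ℕ, Filter.Tendsto q Filter.atTop Filter.atTop ∧ LogAverageSpacing c q ∧
      GapControl c (fun k => Real.exp (-lam * (k : ℝ))) q) :
    (∀ α : ℝ, 0 < α → α ≤ 1 →
      realCapacity (limsupIntervals c fun k => Real.exp (-lam * (k : ℝ) ^ α))
          = realCapacity (Set.Icc 0 1) ∧
        0 < realCapacity (Set.Icc 0 1)) ∧
    (∀ α : ℝ, 1 < α →
      realCapacity (limsupIntervals c fun k => Real.exp (-lam * (k : ℝ) ^ α)) = 0) := by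
  have hc' : ∀ k, c k ∈ Icc (0 : ℝ) 1 := fun k => Ioo_subset_Icc_self (hc k)
  refine ⟨fun α hα hα₁ => ⟨?_, realCapacity_Icc_pos⟩, fun α hα =>
    realCapacity_limsupIntervals_exp_neg_mul_rpow_eq_zero hlam hα c⟩
  obtain ⟨q, hq, hspacing, hgap⟩ := hA23
  refine le_antisymm
    (realCapacity_mono (limsupIntervals_subset_Icc hc' (tendsto_exp_neg_mul_rpow hlam hα))) ?_
  rw [← realCapacity_limsupIntervals_exp_neg_mul_eq hc' hlam hA1 hq hspacing hgap]
  exact realCapacity_mono (limsupIntervals_mono <|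
    (eventually_ge_atTop 1).mono fun k => exp_neg_mul_le_exp_neg_mul_rpow hlam hα₁)
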